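/- Let $r\ge 3$. A finite simple graph is called $C_r$-topological-minor-free if it cannot be modified into the cycle $C_r$ on $r$ vertices by a finite sequence of vertex deletions, edge deletions and vertex dissolutions, where dissolving a vertex $u$ of degree $2$ whose two neighbours $v,w$ are non-adjacent means removing $u$ and adding the edge $vw$. The problem Colouring, restricted to $C_r$-topological-minor-free graphs, is solvable in polynomial time. That is, for each fixed $r\ge 3$ there are a deterministic (multi-stack) Turing machine and a polynomial $p$ such that, for every $C_r$-topological-minor-free graph $G$ and every positive integer $k$, given $(G,k)$ as a word $x$ (the binary expansion of $k$ followed by the rows of the adjacency matrix of $G$), the machine halts within $p(|x|)$ steps and correctly outputs whether $G$ has a $k$-colouring, i.e. a map $c:V(G)\to\{1,\dots,k\}$ with $c(u)\ne c(v)$ for every edge $uv$ of $G$. -/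

import Mathlib

/-- `HasTopologicalMinor H G`: the graph `G` can be modified into (an isomorphic copy of) `H` by a
finite sequence of vertex deletions, edge deletions and vertex dissolutions. Dissolving a vertex `u`
of degree 2 whose two neighbours `v`, `w` are not adjacent means removing `u` and adding the edge
`vw`. -/
inductive HasTopologicalMinor {W : Type} (H : SimpleGraph W) :
    ∀ {V : Type}, SimpleGraph V → Prop
  | iso {V : Type} {G : SimpleGraph V} (e : G ≃g H) : HasTopologicalMinor H G
  | deleteVertex {V : Type} {G : SimpleGraph V} (u : V)
      (h : HasTopologicalMinor H (G.induce {u}ᶜ)) : HasTopologicalMinor H G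
  | deleteEdge {V : Type} {G : SimpleGraph V} (v w : V) (hvw : G.Adj v w)
      (h : HasTopologicalMinor H (G.deleteEdges {s(v, w)})) : HasTopologicalMinor H G
  | dissolveVertex {V : Type} {G : SimpleGraph V} (u v w : V) (hne : v ≠ w)
      (hu : G.neighborSet u = {v, w}) (hvw : ¬ G.Adj v w)
      (h : HasTopologicalMinor H ((G ⊔ SimpleGraph.edge v w).induce {u}ᶜ)) :
      HasTopologicalMinor H G

/-- An instance of the problem Colouring: a finite simple graph and a positive integer `k`. -/
structure ColouringInstance where
  /-- the number of vertices -/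
  n : ℕ
  /-- the graph -/
  graph : SimpleGraph (Fin n)
  /-- the number of available colours -/
  k : ℕ
  k_pos : 0 < k

open Classical in
/-- The input word of an instance, over the alphabet `{0, 1, #}` (`none` is the separator `#`):
the binary expansion of `k`, followed by the rows of the adjacency matrix, each preceded by `#`. -/
noncomputable def ColouringInstance.encode (I : ColouringInstance) : List (Option Bool) :=
  (Computability.encodeNat I.k).map some ++
    (List.finRange I.n).flatMap fun i =>
      none :: (List.finRange I.n).map fun j => some (decide (I.graph.Adj i j))

open Classical in
/-- The answer to an instance: is the graph `k`-colourable? -/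
noncomputable def ColouringInstance.answer (I : ColouringInstance) : Bool :=
  decide (I.graph.Colorable I.k)

/-- Colouring is polynomial-time solvable on the graph class `𝒢`: there are a Turing machine and a
polynomial `p` such that on each instance whose graph lies in `𝒢`, the machine, started on the input
word of the instance, halts after at most `p(length of the input word)` steps and outputs whether
the graph is `k`-colourable. -/
def ColouringPolyTimeSolvableOn (𝒢 : ∀ n : ℕ, SimpleGraph (Fin n) → Prop) : Prop :=
  Nonempty (Turing.TM2ComputableInPolyTime
    (fun I : {I : ColouringInstance // 𝒢 I.n I.graph} => I.1.encode)
    Computability.encodeBool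
    (fun I : {I : ColouringInstance // 𝒢 I.n I.graph} => I.1.answer))

/-! A cycle of length at least `r` shrinks to `C_r`: delete all vertices off the cycle and all its
chords, then dissolve the surplus vertices (`IsCycleSeq.hasTopologicalMinor`). So every cycle of the
input graph is shorter than `r`.

In a depth-first search of such a graph, every edge joins a vertex to one of its ancestors and
closes a cycle with the tree path between them, so the levels of its ends differ by less than `r -
1` (`DFS.level_gap`). This has two consequences. Levels modulo `r` form a proper `r`-colouring, so
only `min r k` matters. And the ancestors adjacent to a vertex lie among the last `r` vertices of
the search path, so whether a colouring of the path extends to the finished branches is governed by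
colourings of such windows, of which there are boundedly many. Every path vertex stores the set of
window colourings that extend below it; a vertex that leaves the path has its own colour projected
out, and the result is intersected into the set of its parent (`DFS.Inv.extendable_iff`,
`DFS.Inv.pop`).

The data kept per vertex thus range over a finite set, and a finite control sweeping over the
adjacency matrix can run the search. A focus mark cycles through the vertices; when it meets one
that is to join or leave the path, that step is made during the sweep. Each vertex joins and leaves
once, so `2 * n * (n + 1)` rounds suffice (`ColouringMachine.exists_halts`), each linear in the
length of the table (`Sweeper.Halts.reach`). -/

/-! ### Long cycles and topological minors. -/

/-- The vertices `p 0, …, p (s - 1)` form, in this order, a cycle of `G`. -/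
structure IsCycleSeq {V : Type} (G : SimpleGraph V) (s : ℕ) (p : ℕ → V) : Prop where
  inj : ∀ i < s, ∀ j < s, p i = p j → i = j
  adj : ∀ i, i + 1 < s → G.Adj (p i) (p (i + 1))
  closing : G.Adj (p (s - 1)) (p 0)

theorem IsCycleSeq.induce {V : Type} {G : SimpleGraph V} {s : ℕ} {p : ℕ → V}
    (h : IsCycleSeq G s p) (hs : 0 < s) {u : V} (hu : ∀ i < s, p i ≠ u) :
    ∃ p', IsCycleSeq (G.induce {u}ᶜ) s p' := by
  -- Only values below `s` matter; the others go to `p 0` so as to stay in the induced graph.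
  refine ⟨fun i => if hi : i < s then ⟨p i, hu i hi⟩ else ⟨p 0, hu 0 hs⟩, ?_, ?_, ?_⟩
  · intro i hi j hj hij
    simp only [hi, hj, dif_pos] at hij
    exact h.inj i hi j hj (congrArg Subtype.val hij)
  · intro i hi
    simpa [hi, Nat.lt_of_succ_lt hi] using h.adj i hi
  · simpa [hs] using h.closing

/-- An edge of the cycle given by `p`. -/
def IsCycleEdge {V : Type} (s : ℕ) (p : ℕ → V) (e : Sym2 V) : Prop :=
  (∃ i, i + 1 < s ∧ e = s(p i, p (i + 1))) ∨ e = s(p (s - 1), p 0)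

theorem IsCycleSeq.deleteEdges {V : Type} {G : SimpleGraph V} {s : ℕ} {p : ℕ → V}
    (h : IsCycleSeq G s p) {e : Sym2 V} (he : ¬ IsCycleEdge s p e) :
    IsCycleSeq (G.deleteEdges {e}) s p := by
  refine ⟨h.inj, fun i hi => ?_, ?_⟩
  · rw [SimpleGraph.deleteEdges_adj]
    exact ⟨h.adj i hi, fun h' => he (Or.inl ⟨i, hi, h'.symm⟩)⟩
  · rw [SimpleGraph.deleteEdges_adj]
    exact ⟨h.closing, fun h' => he (Or.inr h'.symm)⟩

/-- Injectivity of `p` turns equality of edges into arithmetic on indices. -/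
theorem IsCycleSeq.isCycleEdge_iff {V : Type} {G : SimpleGraph V} {s : ℕ} {p : ℕ → V}
    (h : IsCycleSeq G s p) {i j : ℕ} (hi : i < s) (hj : j < s) :
    IsCycleEdge s p s(p i, p j) ↔
      (i + 1 = j ∨ j + 1 = i ∨ (i = s - 1 ∧ j = 0) ∨ (j = s - 1 ∧ i = 0)) := by
  have key : ∀ a < s, ∀ b < s, (p a = p b ↔ a = b) :=
    fun a ha b hb => ⟨h.inj a ha b hb, fun e => e ▸ rfl⟩
  unfold IsCycleEdge
  rw [Sym2.eq_iff, key i hi _ (by omega), key j hj _ (by omega), key i hi _ (by omega),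
    key j hj _ (by omega)]
  constructor
  · rintro (⟨a, ha, hij⟩ | hij)
    · rw [Sym2.eq_iff, key i hi _ (by omega), key j hj _ (by omega), key i hi _ (by omega),
        key j hj _ (by omega)] at hij
      omega
    · omega
  · rintro (rfl | rfl | hij | hij)
    · exact Or.inl ⟨i, hj, rfl⟩
    · exact Or.inl ⟨j, hi, Sym2.eq_swap⟩
    · omega
    · omega

/-- A graph whose vertices and edges are those of a cycle is a cycle graph. -/
theorem IsCycleSeq.nonempty_iso {V : Type} {G : SimpleGraph V} {s : ℕ} {p : ℕ → V}
    (h : IsCycleSeq G s p) (hs : 3 ≤ s) (hV : ∀ u, ∃ i < s, p i = u)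
    (hE : ∀ v w, G.Adj v w → IsCycleEdge s p s(v, w)) :
    Nonempty (G ≃g SimpleGraph.cycleGraph s) := by
  have hadj : ∀ i < s, ∀ j < s, (G.Adj (p i) (p j) ↔
      (i + 1 = j ∨ j + 1 = i ∨ (i = s - 1 ∧ j = 0) ∨ (j = s - 1 ∧ i = 0))) := by
    intro i hi j hj
    rw [← h.isCycleEdge_iff hi hj]
    refine ⟨hE _ _, fun he => ?_⟩
    rcases (h.isCycleEdge_iff hi hj).1 he with rfl | rfl | ⟨rfl, rfl⟩ | ⟨rfl, rfl⟩
    · exact h.adj i hj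
    · exact (h.adj j hi).symm
    · exact h.closing
    · exact h.closing.symm
  let e : Fin s ≃ V := Equiv.ofBijective (fun i => p i)
    ⟨fun i j hij => Fin.ext (h.inj i i.2 j j.2 hij),
      fun u => let ⟨i, hi, hu⟩ := hV u; ⟨⟨i, hi⟩, hu⟩⟩
  refine ⟨(RelIso.symm ⟨e, ?_⟩)⟩
  intro i j
  change G.Adj (p i) (p j) ↔ _
  rw [hadj i i.2 j j.2, SimpleGraph.cycleGraph_adj']
  have hi := i.2
  have hj := j.2
  rcases lt_trichotomy i j with hij | rfl | hij
  · have h₁ := Fin.coe_sub_iff_lt.2 hij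
    have h₂ := Fin.coe_sub_iff_le.2 hij.le
    rw [Fin.lt_def] at hij
    omega
  · have h₁ := Fin.coe_sub_iff_le.2 (le_refl i)
    omega
  · have h₁ := Fin.coe_sub_iff_lt.2 hij
    have h₂ := Fin.coe_sub_iff_le.2 hij.le
    rw [Fin.lt_def] at hij
    omega

/-- Dissolving the last vertex of a chordless cycle. -/
theorem IsCycleSeq.dissolve {V : Type} {G : SimpleGraph V} {s : ℕ} {p : ℕ → V}
    (h : IsCycleSeq G (s + 1) p) (hs : 3 ≤ s) :
    ∃ p', IsCycleSeq ((G ⊔ SimpleGraph.edge (p (s - 1)) (p 0)).induce {p s}ᶜ) s p' := by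
  refine IsCycleSeq.induce (p := p) ⟨?_, ?_, ?_⟩ (by omega) ?_
  · exact fun i hi j hj => h.inj i (by omega) j (by omega)
  · exact fun i hi => Or.inl (h.adj i (by omega))
  · refine Or.inr ?_
    rw [SimpleGraph.edge_adj]
    refine ⟨Or.inl ⟨rfl, rfl⟩, fun e => ?_⟩
    have := h.inj _ (by omega) _ (by omega) e
    omega
  · intro i hi e
    have := h.inj _ (by omega) _ (by omega) e
    omega

/-- A graph with a cycle of length at least `r` has the cycle of length `r` as a topological
minor. -/
theorem IsCycleSeq.hasTopologicalMinor {V : Type} [Finite V] {G : SimpleGraph V} {r s : ℕ}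
    {p : ℕ → V} (h : IsCycleSeq G s p) (hr : 3 ≤ r) (hs : r ≤ s) :
    HasTopologicalMinor (SimpleGraph.cycleGraph r) G := by
  -- Outer induction on the number of vertices (deletion, dissolution), inner induction on the
  -- number of edges (deletion of chords).
  obtain ⟨N, hN⟩ : ∃ N, Nat.card V = N := ⟨_, rfl⟩
  induction N using Nat.strong_induction_on generalizing V s with
  | _ N ihN =>
  obtain ⟨M, hM⟩ : ∃ M, G.edgeSet.ncard = M := ⟨_, rfl⟩
  induction M using Nat.strong_induction_on generalizing G with
  | _ M ihM =>
  have hcard : ∀ u : V, Nat.card ({u}ᶜ : Set V) < N := fun u => by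
    rw [← hN]
    exact Set.ncard_lt_card (s := ({u}ᶜ : Set V)) (by simp)
  by_cases hV : ∀ u, ∃ i < s, p i = u
  swap
  · push Not at hV
    obtain ⟨u, hu⟩ := hV
    obtain ⟨p', hp'⟩ := h.induce (by omega) hu
    exact .deleteVertex u (ihN _ (hcard u) hp' hs rfl)
  by_cases hE : ∀ v w, G.Adj v w → IsCycleEdge s p s(v, w)
  swap
  · push Not at hE
    obtain ⟨v, w, hvw, he⟩ := hE
    refine .deleteEdge v w hvw (ihM _ ?_ (h.deleteEdges he) rfl)
    rw [← hM]
    refine Set.ncard_lt_ncard ?_ (Set.toFinite _)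
    rw [SimpleGraph.edgeSet_deleteEdges]
    exact ⟨Set.sdiff_subset, fun hsub => (hsub (show s(v, w) ∈ G.edgeSet from hvw)).2 rfl⟩
  rcases hs.eq_or_lt with rfl | hlt
  · exact .iso (h.nonempty_iso hr hV hE).some
  obtain ⟨s, rfl⟩ : ∃ t, s = t + 1 := ⟨s - 1, by omega⟩
  have hclosing := h.closing
  have hlast := h.adj (s - 1) (by omega)
  rw [Nat.add_sub_cancel] at hclosing
  rw [Nat.sub_add_cancel (by omega)] at hlast
  obtain ⟨p', hp'⟩ := h.dissolve (by omega)
  refine .dissolveVertex (p s) (p (s - 1)) (p 0) ?_ ?_ ?_ (ihN _ (hcard _) hp' (by omega) rfl)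
  · intro e
    have := h.inj _ (by omega) _ (by omega) e
    omega
  · ext w
    obtain ⟨j, hj, rfl⟩ := hV w
    simp only [SimpleGraph.mem_neighborSet, Set.mem_insert_iff, Set.mem_singleton_iff]
    constructor
    · intro hw
      rcases (h.isCycleEdge_iff (by omega) hj).1 (hE _ _ hw) with e | e | e | e
      · omega
      · exact Or.inl (by rw [← e]; rfl)
      · exact Or.inr (by rw [e.2])
      · omega
    · rintro (e | e) <;> rw [e]
      · exact hlast.symm
      · exact hclosing
  -- The remaining graph is a chordless cycle of length `s + 1 ≥ 4`, so the two neighbours of `p s`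
  -- are not adjacent.
  · intro hw
    have := (h.isCycleEdge_iff (by omega) (by omega)).1 (hE _ _ hw)
    omega

/-! ### Sweeping machines and their simulation by a Turing machine. -/

/-- A deterministic machine with finite control `Q` that first turns its input, symbol by symbol,
into a list of cells, and then sweeps back and forth over these cells, rewriting each of them. -/
structure Sweeper (X Q A : Type) where
  /-- the initial control state -/
  init : Q
  /-- what is done with an input symbol -/
  read : Q → X → Q × Option A
  /-- what is done with a cell in a backward sweep -/
  back : Q → A → Q × A
  /-- the change of control at the end of a backward sweep -/
  turn : Q → Q
  /-- the verdict at the end of a backward sweep, if there is one -/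
  verdict : Q → Option Bool
  /-- what is done with a cell in a forward sweep -/
  forth : Q → A → Q × A
  /-- the change of control at the end of a forward sweep -/
  restart : Q → Q

namespace Sweeper

open Turing

variable {X Q A : Type}

/-- A sweep with transducer `δ` over `l`; the new cells are pushed onto `acc`. -/
def sweep (δ : Q → A → Q × A) : Q → List A → List A → Q × List A
  | q, [], acc => (q, acc)
  | q, a :: l, acc => sweep δ (δ q a).1 l ((δ q a).2 :: acc)

/-- Reading the input. -/
def readAll (S : Sweeper X Q A) : Q → List X → List A → Q × List A
  | q, [], acc => (q, acc)
  | q, x :: l, acc => S.readAll (S.read q x).1 l ((S.read q x).2.toList ++ acc)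

/-- `S.Halts q w t b`: started in state `q` on the cells `w` (last one first), the machine gives the
verdict `b` after `t` rounds. -/
inductive Halts (S : Sweeper X Q A) : Q → List A → ℕ → Bool → Prop
  | final {q w b} (h : S.verdict (S.turn (sweep S.back q w []).1) = some b) : S.Halts q w 0 b
  | round {q w t b} (h : S.verdict (S.turn (sweep S.back q w []).1) = none)
      (h' : S.Halts
        (S.restart (sweep S.forth (S.turn (sweep S.back q w []).1) (sweep S.back q w []).2 []).1)
        (sweep S.forth (S.turn (sweep S.back q w []).1) (sweep S.back q w []).2 []).2 t b) :
      S.Halts q w (t + 1) b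

theorem length_sweep (δ : Q → A → Q × A) (q : Q) (l acc : List A) :
    (sweep δ q l acc).2.length = l.length + acc.length := by
  induction l generalizing q acc with
  | nil => simp [sweep]
  | cons a l ih => simp only [sweep, ih, List.length_cons]; omega

theorem length_readAll_le (S : Sweeper X Q A) (q : Q) (l : List X) (acc : List A) :
    (S.readAll q l acc).2.length ≤ l.length + acc.length := by
  induction l generalizing q acc with
  | nil => simp [readAll]
  | cons a l ih =>
    refine (ih _ _).trans ?_
    cases (S.read q a).2 <;> (simp; try omega)

theorem readAll_append (S : Sweeper X Q A) (q : Q) (l l' : List X) (acc : List A) :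
    S.readAll q (l ++ l') acc = S.readAll (S.readAll q l acc).1 l' (S.readAll q l acc).2 := by
  induction l generalizing q acc with
  | nil => rfl
  | cons a l ih => exact ih _ _

theorem sweep_append (δ : Q → A → Q × A) (q : Q) (l l' : List A) (acc : List A) :
    sweep δ q (l ++ l') acc = sweep δ (sweep δ q l acc).1 l' (sweep δ q l acc).2 := by
  induction l generalizing q acc with
  | nil => rfl
  | cons a l ih => exact ih _ _

/-- The contents of the Turing machine that simulates a sweeper. -/
inductive Stack
  | input | left | right | output
  deriving DecidableEq

instance : Fintype Stack :=
  ⟨{.input, .left, .right, .output}, fun k => by cases k <;> simp⟩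

/-- The labels of the Turing machine that simulates a sweeper. -/
inductive Label
  | read | back | forth | clear
  deriving DecidableEq

instance : Fintype Label :=
  ⟨{.read, .back, .forth, .clear}, fun l => by cases l <;> simp⟩

/-- The stack alphabets. -/
abbrev Alphabet (X A : Type) : Stack → Type
  | .input => X
  | .left => A
  | .right => A
  | .output => Bool

/-- The internal states: a control state and the symbols just popped. -/
abbrev Mem (X Q A : Type) : Type := Q × Option X × Option A

/-- The program of the Turing machine that simulates a sweeper. -/
def program [Inhabited A] (S : Sweeper X Q A) :
    Label → TM2.Stmt (Alphabet X A) Label (Mem X Q A)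
  | .read =>
    .pop .input (fun v o => (v.1, o, none)) <|
    .branch (fun v => v.2.1.isSome)
      (.load (fun v => (v.1, v.2.1, v.2.1.bind fun x => (S.read v.1 x).2)) <|
        .branch (fun v => v.2.2.isSome)
          -- The branch guarantees a symbol, so `default` is never pushed.
          (.push .left (fun v => (v.2.2.getD default : A)) <|
            .load (fun v => ((v.2.1.map fun x => (S.read v.1 x).1).getD v.1, none, none)) <|
            .goto fun _ => .read)
          (.load (fun v => ((v.2.1.map fun x => (S.read v.1 x).1).getD v.1, none, none)) <|
            .goto fun _ => .read))
      (.goto fun _ => .back)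
  | .back =>
    .pop .left (fun v o => (v.1, none, o)) <|
    .branch (fun v => v.2.2.isSome)
      (.push .right (fun v => (S.back v.1 (v.2.2.getD default)).2) <|
        .load (fun v => ((S.back v.1 (v.2.2.getD default)).1, none, none)) <|
        .goto fun _ => .back)
      (.load (fun v => (S.turn v.1, none, none)) <|
        .goto fun v => if (S.verdict v.1).isSome then .clear else .forth)
  | .forth =>
    .pop .right (fun v o => (v.1, none, o)) <|
    .branch (fun v => v.2.2.isSome)
      (.push .left (fun v => (S.forth v.1 (v.2.2.getD default)).2) <|
        .load (fun v => ((S.forth v.1 (v.2.2.getD default)).1, none, none)) <|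
        .goto fun _ => .forth)
      (.load (fun v => (S.restart v.1, none, none)) <| .goto fun _ => .back)
  -- `haltList` requires the initial memory and all stacks empty except the output.
  | .clear =>
    .pop .right (fun v o => (v.1, none, o)) <|
    .branch (fun v => v.2.2.isSome)
      (.load (fun v => (v.1, none, none)) <| .goto fun _ => .clear)
      (.push .output (fun v => ((S.verdict v.1).getD false : Bool)) <|
        .load (fun _ => (S.init, none, none)) .halt)

/-- The Turing machine that simulates a sweeper. -/
def toTM [Inhabited A] [Fintype X] [Fintype Q] [Fintype A] (S : Sweeper X Q A) : FinTM2 where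
  K := Stack
  k₀ := .input
  k₁ := .output
  Γ := Alphabet X A
  Λ := Label
  main := .read
  σ := Mem X Q A
  initialState := (S.init, none, none)
  Γk₀Fin := inferInstanceAs (Fintype X)
  m := S.program

/-- The contents of the contents. -/
def contents (x : List X) (a b : List A) (o : List Bool) : ∀ k, List (Alphabet X A k)
  | .input => x
  | .left => a
  | .right => b
  | .output => o

theorem update_input (x x' : List X) (a b : List A) (o : List Bool) :
    Function.update (contents x a b o) .input x' = contents x' a b o := by
  funext k; cases k <;> rfl

theorem update_left (x : List X) (a a' b : List A) (o : List Bool) :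
    Function.update (contents x a b o) .left a' = contents x a' b o := by
  funext k; cases k <;> rfl

theorem update_right (x : List X) (a b b' : List A) (o : List Bool) :
    Function.update (contents x a b o) .right b' = contents x a b' o := by
  funext k; cases k <;> rfl

theorem update_output (x : List X) (a b : List A) (o o' : List Bool) :
    Function.update (contents x a b o) .output o' = contents x a b o' := by
  funext k; cases k <;> rfl

variable [Inhabited A] (S : Sweeper X Q A)

/-- A configuration of the simulating machine. -/
def cfg (l : Option Label) (q : Q) (x : List X) (a b : List A) (o : List Bool) :
    TM2.Cfg (Alphabet X A) Label (Mem X Q A) :=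
  ⟨l, (q, none, none), contents x a b o⟩

/-- `S.Reach c c' t`: the configuration `c'` is reached from `c` in exactly `t` steps. -/
def Reach (c c' : TM2.Cfg (Alphabet X A) Label (Mem X Q A)) (t : ℕ) : Prop :=
  (flip bind (TM2.step S.program))^[t] (some c) = some c'

variable {S}

theorem Reach.trans {c c' c'' : TM2.Cfg (Alphabet X A) Label (Mem X Q A)} {t t' : ℕ}
    (h : S.Reach c c' t) (h' : S.Reach c' c'' t') : S.Reach c c'' (t + t') := by
  unfold Reach at *
  rw [add_comm, Function.iterate_add_apply, h, h']

theorem Reach.head {c c' c'' : TM2.Cfg (Alphabet X A) Label (Mem X Q A)} {t : ℕ}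
    (h : TM2.step S.program c = some c') (h' : S.Reach c' c'' t) : S.Reach c c'' (t + 1) := by
  rw [add_comm]
  exact Reach.trans (t := 1) h h'

variable (S)

theorem step_read_cons (q : Q) (y : X) (x : List X) (a : List A) :
    TM2.step S.program (cfg (some .read) q (y :: x) a [] []) =
      some (cfg (some .read) (S.read q y).1 x ((S.read q y).2.toList ++ a) [] []) := by
  change some (TM2.stepAux (S.program .read) _ _) = _
  rcases h : (S.read q y).2 with _ | c <;>
    simp [program, contents, h, cfg, update_left, update_input]

theorem step_read_nil (q : Q) (a : List A) :
    TM2.step S.program (cfg (some .read) q [] a [] []) = some (cfg (some .back) q [] a [] []) := by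
  change some (TM2.stepAux (S.program .read) _ _) = _
  simp [program, cfg, contents, update_input]

theorem step_back_cons (q : Q) (c : A) (a b : List A) :
    TM2.step S.program (cfg (some .back) q [] (c :: a) b []) =
      some (cfg (some .back) (S.back q c).1 [] a ((S.back q c).2 :: b) []) := by
  change some (TM2.stepAux (S.program .back) _ _) = _
  simp [program, cfg, contents, update_left, update_right]

theorem step_back_nil (q : Q) (b : List A) :
    TM2.step S.program (cfg (some .back) q [] [] b []) =
      some (cfg (some (if (S.verdict (S.turn q)).isSome then .clear else .forth))
        (S.turn q) [] [] b []) := by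
  change some (TM2.stepAux (S.program .back) _ _) = _
  simp [program, cfg, contents, update_left, update_right]

theorem step_forth_cons (q : Q) (c : A) (a b : List A) :
    TM2.step S.program (cfg (some .forth) q [] a (c :: b) []) =
      some (cfg (some .forth) (S.forth q c).1 [] ((S.forth q c).2 :: a) b []) := by
  change some (TM2.stepAux (S.program .forth) _ _) = _
  simp [program, cfg, contents, update_left, update_right]

theorem step_forth_nil (q : Q) (a : List A) :
    TM2.step S.program (cfg (some .forth) q [] a [] []) =
      some (cfg (some .back) (S.restart q) [] a [] []) := by
  change some (TM2.stepAux (S.program .forth) _ _) = _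
  simp [program, cfg, contents, update_left, update_right]

theorem step_clear_cons (q : Q) (c : A) (b : List A) :
    TM2.step S.program (cfg (some .clear) q [] [] (c :: b) []) =
      some (cfg (some .clear) q [] [] b []) := by
  change some (TM2.stepAux (S.program .clear) _ _) = _
  simp [program, cfg, contents, update_right]

theorem step_clear_nil (q : Q) (v : Bool) (hv : S.verdict q = some v) :
    TM2.step S.program (cfg (some .clear) q [] [] [] []) =
      some (cfg none S.init [] [] [] [v]) := by
  change some (TM2.stepAux (S.program .clear) _ _) = _
  simp [program, cfg, contents, hv, update_output, update_right]

theorem reach_read (q : Q) (x : List X) (a : List A) :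
    S.Reach (cfg (some .read) q x a [] [])
      (cfg (some .back) (S.readAll q x a).1 [] (S.readAll q x a).2 [] []) (x.length + 1) := by
  induction x generalizing q a with
  | nil => exact S.step_read_nil q a
  | cons y x ih => exact .head (S.step_read_cons q y x a) (ih _ _)

theorem reach_back (q : Q) (a b : List A) :
    S.Reach (cfg (some .back) q [] a b [])
      (cfg (some .back) (sweep S.back q a b).1 [] [] (sweep S.back q a b).2 []) a.length := by
  induction a generalizing q b with
  | nil => rfl
  | cons y a ih => exact .head (S.step_back_cons q y a b) (ih _ _)

theorem reach_forth (q : Q) (a b : List A) :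
    S.Reach (cfg (some .forth) q [] a b [])
      (cfg (some .back) (S.restart (sweep S.forth q b a).1) [] (sweep S.forth q b a).2 [] [])
      (b.length + 1) := by
  induction b generalizing q a with
  | nil => exact S.step_forth_nil q a
  | cons y b ih => exact .head (S.step_forth_cons q y a b) (ih _ _)

theorem reach_clear (q : Q) (v : Bool) (hv : S.verdict q = some v) (b : List A) :
    S.Reach (cfg (some .clear) q [] [] b []) (cfg none S.init [] [] [] [v])
      (b.length + 1) := by
  induction b with
  | nil => exact S.step_clear_nil q v hv
  | cons y b ih => exact .head (S.step_clear_cons q y b) ih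

variable {S}

/-- With the change of label, each sweep costs `w.length + 1` steps. In the last round, clearing the
right stack takes the place of the forward sweep. -/
theorem Halts.reach {q : Q} {w : List A} {t : ℕ} {v : Bool} (h : S.Halts q w t v) :
    S.Reach (cfg (some .back) q [] w [] []) (cfg none S.init [] [] [] [v])
      ((t + 1) * (2 * w.length + 2)) := by
  induction h with
  | @final q w b h =>
    have h₁ := S.reach_back q w []
    have h₂ := S.step_back_nil (sweep S.back q w []).1 (sweep S.back q w []).2
    rw [h] at h₂
    have h₃ := h₁.trans (Reach.head h₂ (S.reach_clear _ _ h _))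
    rw [length_sweep] at h₃
    convert h₃ using 1
    simp only [List.length_nil]
    ring
  | @round q w t b h _ ih =>
    have h₁ := S.reach_back q w []
    have h₂ := S.step_back_nil (sweep S.back q w []).1 (sweep S.back q w []).2
    rw [h] at h₂
    have h₃ := (h₁.trans (Reach.head h₂ (S.reach_forth _ _ _))).trans ih
    simp only [length_sweep, List.length_nil] at h₃
    convert h₃ using 1
    ring

theorem initList_toTM (S : Sweeper X Q A) [Fintype X] [Fintype Q] [Fintype A] (x : List X) :
    initList S.toTM x = cfg (some .read) S.init x [] [] [] := by
  simp only [initList, cfg]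
  congr 1
  funext k
  cases k <;> rfl

theorem haltList_toTM (S : Sweeper X Q A) [Fintype X] [Fintype Q] [Fintype A] (b : Bool) :
    haltList S.toTM [b] = cfg none S.init [] [] [] [b] := by
  simp only [haltList, cfg]
  congr 1
  funext k
  cases k <;> rfl

/-- A problem solved by a sweeper in polynomially many rounds is solvable in polynomial time. -/
theorem nonempty_polyTime [Fintype X] [Fintype Q] [Fintype A] {α : Type} (S : Sweeper X Q A)
    (e : α → List X) (f : α → Bool) (T : Polynomial ℕ)
    (h : ∀ a, ∃ t ≤ T.eval (e a).length,
      S.Halts (S.readAll S.init (e a) []).1 (S.readAll S.init (e a) []).2 t (f a)) :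
    Nonempty (TM2ComputableInPolyTime e Computability.encodeBool f) := by
  choose t ht hH using h
  refine ⟨{
    tm := S.toTM
    inputAlphabet := Equiv.refl X
    outputAlphabet := Equiv.refl Bool
    -- Reading, then `Halts.reach`; the number of cells is at most the length of the input.
    time := (Polynomial.X + 1) + (T + 1) * (2 * Polynomial.X + 2)
    outputsFun := fun a => ⟨⟨((e a).length + 1) +
      (t a + 1) * (2 * (S.readAll S.init (e a) []).2.length + 2), ?_⟩, ?_⟩ }⟩
  · have hr := (S.reach_read S.init (e a) []).trans (hH a).reach
    have hi := S.initList_toTM ((e a).map (Equiv.refl X).invFun)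
    rw [show (cfg (some Label.read) S.init ((e a).map (Equiv.refl X).invFun) [] [] [] :
      TM2.Cfg (Alphabet X A) Label (Mem X Q A)) = cfg (some Label.read) S.init (e a) [] [] [] from
      congrArg (fun x => cfg (some Label.read) S.init x [] [] []) (List.map_id _)] at hi
    have ho := S.haltList_toTM (f a)
    rw [← hi, ← ho] at hr
    exact hr
  · have := S.length_readAll_le S.init (e a) []
    simp only [Polynomial.eval_add, Polynomial.eval_mul, Polynomial.eval_X, Polynomial.eval_one,
      Polynomial.eval_ofNat]
    simp only [List.length_nil, add_zero] at this
    gcongr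
    exact ht a

end Sweeper

/-! ### The local rules of the search. -/

/-- The status of a vertex in a depth-first search. An active vertex, that is, one on the current
search path, stores its level modulo `r`, whether it is the last vertex of the path, and the set of
those colourings of the last `r` vertices of the path up to it that extend to the finished branches
below it. -/
inductive Status (r : ℕ)
  | unvisited
  | done
  | active (l : ZMod r) (tip : Bool) (S : Set (ZMod r → Fin r))

namespace DFS

open Classical

/-- What is known of a vertex `j` when the search looks at the vertex `v`: the status of `j`,
whether `j = v`, and whether `j` and `v` are adjacent. -/
abbrev Info (r : ℕ) : Type := Status r × Bool × Bool

variable {r : ℕ}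

/-- The vertex in focus is to be appended to the search path, at level `l`. -/
def IsPush (g : Set (Info r)) (l : ZMod r) : Prop :=
  (∃ b, (.unvisited, true, b) ∈ g) ∧
    ((∃ l' S f, (.active l' true S, f, true) ∈ g ∧ l = l' + 1) ∨
      -- Without a tip the path is empty, and the vertex becomes the root of a new component.
      ((∀ l' S f b, (.active l' true S, f, b) ∉ g) ∧ l = 0))

/-- The vertex in focus is the last one of the search path and is to be removed from it. -/
def IsPop (g : Set (Info r)) (l : ZMod r) (S : Set (ZMod r → Fin r)) : Prop :=
  (∃ b, (.active l true S, true, b) ∈ g) ∧ ∀ f, (.unvisited, f, true) ∉ g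

/-- The colourings of the window of the parent that extend to the vertex in focus, which has level
`l` and stores the set `S`. -/
def extendable (k : ℕ) (g : Set (Info r)) (l : ZMod r) (S : Set (ZMod r → Fin r)) :
    Set (ZMod r → Fin r) :=
  {f | ∃ x : Fin r, x.val < k ∧ Function.update f l x ∈ S ∧
    ∀ i t S' fo, (.active i t S', fo, true) ∈ g → f i ≠ x}

/-- An active vertex ceases to be the last one of the search path. -/
def lower : Status r → Status r
  | .unvisited => .unvisited
  | .done => .done
  | .active l _ S => .active l false S

/-- The new status of a neighbour of the vertex removed from the search path, which has level `l`
and leaves the set `T` of extendable colourings. -/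
noncomputable def raise (l : ZMod r) (T : Set (ZMod r → Fin r)) : Status r → Status r
  | .unvisited => .unvisited
  | .done => .done
  | .active l' t S => if l' + 1 = l then .active l' true (S ∩ T) else .active l' t S

/-- The new status of a vertex. -/
noncomputable def next (k : ℕ) (g : Set (Info r)) (x : Info r) : Status r :=
  if h : ∃ l, IsPush g l then
    if x.2.1 then .active h.choose true Set.univ else lower x.1
  else if h : ∃ y : ZMod r × Set (ZMod r → Fin r), IsPop g y.1 y.2 then
    if x.2.1 then .done
    else if x.2.2 then raise h.choose.1 (extendable k g h.choose.1 h.choose.2) x.1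
    else x.1
  else x.1

/-- The vertex in focus is the removed root of a component that has no `k`-colouring. -/
def Fails [NeZero r] (k : ℕ) (g : Set (Info r)) : Prop :=
  ∃ l S, IsPop g l S ∧ (∀ l' t S' f, (.active l' t S', f, true) ∈ g → l' + 1 ≠ l) ∧
    -- The constant `0` is the window of the empty path, which is what remains once a root is
    -- removed.
    (fun _ => 0) ∉ extendable k g l S

/-- Every vertex has been dealt with. -/
def Finished (g : Set (Info r)) : Prop :=
  ∀ f b, (.unvisited, f, b) ∉ g ∧ ∀ l S, (.active l true S, f, b) ∉ g

/-- The vertex in focus is to be appended to the search path or to be removed from it. -/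
def Enabled (g : Set (Info r)) : Prop :=
  (∃ l, IsPush g l) ∨ ∃ l S, IsPop g l S

theorem next_of_not_enabled {k : ℕ} {g : Set (Info r)} (h : ¬ Enabled g) (x : Info r) :
    next k g x = x.1 := by
  simp only [Enabled, not_or] at h
  rw [next, dif_neg h.1, dif_neg]
  rintro ⟨y, hy⟩
  exact h.2 ⟨_, _, hy⟩

theorem not_fails_of_not_enabled [NeZero r] {k : ℕ} {g : Set (Info r)} (h : ¬ Enabled g) :
    ¬ Fails k g :=
  fun ⟨l, S, h', _⟩ => h (Or.inr ⟨l, S, h'⟩)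

/-! ### Windows, level gaps and the invariant. -/

variable {V : Type}

/-- The colouring by `c` of the last `r` vertices of a path (given by its vertices, last one
first), indexed by their levels. -/
def window [NeZero r] (c : V → Fin r) : List V → ZMod r → Fin r
  | [] => fun _ => 0
  | v :: q => Function.update (window c q) (q.length : ZMod r) (c v)

theorem window_congr [NeZero r] {c c' : V → Fin r} {q : List V} (h : ∀ v ∈ q, c v = c' v) :
    window c q = window c' q := by
  induction q with
  | nil => rfl
  | cons v q ih =>
    rw [window, window, ih fun w hw => h w (List.mem_cons_of_mem _ hw), h v List.mem_cons_self]

/-- Levels are stored modulo `r` only; this recovers equality for levels less than `r` apart. -/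
theorem natCast_inj_of_lt {a b : ℕ} (h : (a : ZMod r) = b) (hab : a ≤ b) (hb : b < a + r) :
    a = b := by
  have h' := (Nat.modEq_iff_dvd' hab).1 ((ZMod.natCast_eq_natCast_iff _ _ _).1 h)
  have := Nat.eq_zero_of_dvd_of_lt h' (by omega)
  omega

/-- The entry of `w` can only be overwritten by a vertex `r` levels further down the path, and `q`
does not reach that far. -/
theorem window_apply [NeZero r] {c : V → Fin r} {w : V} {q' q : List V} (h : (w :: q') <:+ q)
    (hq : q.length ≤ q'.length + r) : window c q (q'.length : ZMod r) = c w := by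
  induction q with
  | nil => simp at h
  | cons v q ih =>
    rw [List.length_cons] at hq
    rcases List.suffix_cons_iff.1 h with h | h
    · obtain ⟨rfl, rfl⟩ := List.cons.inj h
      rw [window, Function.update_self]
    · have hl := h.length_le
      rw [List.length_cons] at hl
      rw [window, Function.update_of_ne, ih h (by omega)]
      intro e
      have := natCast_inj_of_lt e (by omega) (by omega)
      omega

/-- The edge `vw` closes the path to a cycle. `l` may be empty, since `IsCycleSeq` also admits a
single edge as a cycle of length 2. -/
theorem length_lt_of_closed_path {G : SimpleGraph V} (hG : ∀ s p, IsCycleSeq G s p → s < r)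
    {v w : V} {l : List V} (hd : (v :: l ++ [w]).Nodup) (hc : (v :: l ++ [w]).IsChain G.Adj)
    (hvw : G.Adj v w) : l.length + 2 < r := by
  set L := v :: l ++ [w] with hL
  have hlen : L.length = l.length + 2 := by simp [hL]
  refine hG _ (fun i => L.getD i v) ⟨?_, ?_, ?_⟩
  · intro i hi j hj hij
    rw [← hlen] at hi hj
    simp only [List.getD_eq_getElem _ _ hi, List.getD_eq_getElem _ _ hj] at hij
    exact (List.Nodup.getElem_inj_iff hd).1 hij
  · intro i hi
    rw [← hlen] at hi
    simp only [List.getD_eq_getElem _ _ hi, List.getD_eq_getElem _ _ (Nat.lt_of_succ_lt hi)]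
    exact List.isChain_iff_getElem.1 hc i hi
  · have h₁ : L.getD (l.length + 2 - 1) v = w := by simp [hL]
    have h₂ : L.getD 0 v = v := rfl
    simp only [h₁, h₂]
    exact hvw.symm

/-- Without long cycles, edges between vertices of a path join vertices of almost equal levels. -/
theorem level_gap {G : SimpleGraph V} (hG : ∀ s p, IsCycleSeq G s p → s < r)
    {v w : V} {q q' : List V} (hd : (v :: q).Nodup) (hc : (v :: q).IsChain G.Adj)
    (h : (w :: q') <:+ q) (hvw : G.Adj v w) : q.length + 1 < q'.length + r := by
  obtain ⟨l, rfl⟩ := h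
  have e : v :: (l ++ w :: q') = (v :: l ++ [w]) ++ q' := by simp
  rw [e] at hd hc
  have := length_lt_of_closed_path hG hd.of_append_left hc.left_of_append hvw
  simp only [List.length_append, List.length_cons]
  omega

theorem exists_suffix_of_mem {v : V} {p : List V} (h : v ∈ p) : ∃ q, (v :: q) <:+ p := by
  obtain ⟨l, q, rfl⟩ := List.append_of_mem h
  exact ⟨q, l, rfl⟩

/-- `c` is a proper colouring with `k` colours as far as the finished vertices are concerned. -/
def ProperOnDone (G : SimpleGraph V) (k : ℕ) (st : V → Status r) (c : V → Fin r) : Prop :=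
  ∀ d, st d = .done → (c d).val < k ∧ ∀ w, G.Adj d w → c d ≠ c w

/-- The invariant of the depth-first search: `p` is the search path (last vertex first), `S` gives
the stored sets of colourings and `lv` the levels modulo `r`. -/
structure Inv [NeZero r] (G : SimpleGraph V) (k : ℕ) (st : V → Status r) (fail : Prop)
    (p : List V) (S : V → Set (ZMod r → Fin r)) (lv : V → ZMod r) : Prop where
  nodup : p.Nodup
  chain : p.IsChain G.Adj
  active : ∀ v q, (v :: q) <:+ p →
    st v = .active q.length (decide (q.length + 1 = p.length)) (S v)
  inactive : ∀ v, v ∉ p → st v = .unvisited ∨ st v = .done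
  closed : ∀ d w, st d = .done → G.Adj d w → st w ≠ .unvisited
  level : ∀ v q, (v :: q) <:+ p → lv v = q.length
  -- `lv` also remembers the levels of finished vertices, which the statuses forget; in the end it
  -- is a proper colouring by `ZMod r`.
  level_ne : ∀ d w, st d = .done → G.Adj d w → lv d ≠ lv w
  -- Correctness of the dynamic programme: the stored sets together describe exactly the path
  -- colourings that extend to the finished vertices.
  ext : ¬ fail → ∀ c : V → Fin r, (∀ v q, (v :: q) <:+ p → window c (v :: q) ∈ S v) ↔
    ∃ c', (∀ v ∈ p, c' v = c v) ∧ ProperOnDone G k st c'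
  not_colorable : fail → ¬ ∃ c : V → Fin r, ∀ v, (c v).val < k ∧ ∀ w, G.Adj v w → c v ≠ c w

/-- What is known of the vertices when the search looks at `v`. -/
noncomputable def info (G : SimpleGraph V) (st : V → Status r) (v j : V) : Info r :=
  (st j, decide (j = v), decide (G.Adj j v))

theorem mem_range_info {G : SimpleGraph V} {st : V → Status r} {v : V} {s : Status r} {f b : Bool} :
    (s, f, b) ∈ Set.range (info G st v) ↔
      ∃ j, st j = s ∧ (j = v ↔ f = true) ∧ (G.Adj j v ↔ b = true) := by
  simp only [Set.mem_range, info, Prod.mk.injEq]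
  refine exists_congr fun j => and_congr_right fun _ => and_congr ?_ ?_
  · cases f <;> simp
  · cases b <;> simp

/-! ### Preservation of the invariant. -/

namespace Inv

variable [NeZero r] {G : SimpleGraph V} {k : ℕ} {st : V → Status r} {fail : Prop}
  {p : List V} {S : V → Set (ZMod r → Fin r)} {lv : V → ZMod r}

theorem exists_of_active (h : Inv G k st fail p S lv) {v : V} {l : ZMod r} {t : Bool}
    {S' : Set (ZMod r → Fin r)} (hv : st v = .active l t S') :
    ∃ q, (v :: q) <:+ p ∧ l = q.length ∧ (t = true ↔ v :: q = p) ∧ S' = S v := by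
  have hp : v ∈ p := by
    by_contra hp
    rcases h.inactive v hp with e | e <;> rw [e] at hv <;> cases hv
  obtain ⟨q, hq⟩ := exists_suffix_of_mem hp
  have e := h.active v q hq
  rw [hv] at e
  injection e with e₁ e₂ e₃
  refine ⟨q, hq, e₁, ?_, e₃⟩
  rw [e₂, decide_eq_true_iff]
  exact ⟨fun e => hq.eq_of_length e, fun e => by rw [← e, List.length_cons]⟩

theorem notMem_of_unvisited (h : Inv G k st fail p S lv) {v : V} (hv : st v = .unvisited) :
    v ∉ p := fun hp => by
  obtain ⟨q, hq⟩ := exists_suffix_of_mem hp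
  rw [h.active v q hq] at hv
  cases hv

theorem notMem_of_done (h : Inv G k st fail p S lv) {v : V} (hv : st v = .done) :
    v ∉ p := fun hp => by
  obtain ⟨q, hq⟩ := exists_suffix_of_mem hp
  rw [h.active v q hq] at hv
  cases hv

/-- A vertex of the path that is adjacent to its last vertex. -/
theorem exists_of_active_adj (h : Inv G k st fail p S lv) {u v : V} {q : List V} (hp : p = v :: q)
    {l : ZMod r} {t : Bool} {S' : Set (ZMod r → Fin r)} (hu : st u = .active l t S')
    (huv : G.Adj u v) :
    ∃ q', (u :: q') <:+ q ∧ l = q'.length ∧ t = false ∧ S' = S u := by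
  obtain ⟨q', hq', hl, ht, hS⟩ := h.exists_of_active hu
  rw [hp] at hq' ht
  rcases List.suffix_cons_iff.1 hq' with e | e
  · exact absurd (List.cons.inj e).1 huv.ne
  · refine ⟨q', e, hl, ?_, hS⟩
    by_contra ht'
    have := ht.1 (by simpa using ht')
    exact huv.ne (List.cons.inj this).1

/-- No finished vertex is adjacent to the unvisited `u`, so the colour of `u` is still free and
`Set.univ` is the right set to store. -/
theorem push (h : Inv G k st fail p S lv) {u : V} (hu : st u = .unvisited)
    (hup : (u :: p).IsChain G.Adj) {st' : V → Status r}
    (hst : ∀ v, st' v = if v = u then .active p.length true Set.univ else lower (st v)) :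
    Inv G k st' fail (u :: p) (Function.update S u Set.univ)
      (Function.update lv u p.length) := by
  have hu' := h.notMem_of_unvisited hu
  have hdone : ∀ d, st' d = .done ↔ st d = .done := by
    intro d
    rw [hst]
    split_ifs with hd
    · rw [hd, hu]
      simp
    · cases st d <;> simp [lower]
  have hunv : ∀ d, st' d = .unvisited → st d = .unvisited := by
    intro d
    rw [hst]
    split_ifs with hd
    · simp
    · cases st d <;> simp [lower]
  have hne : ∀ v q, (v :: q) <:+ p → v ≠ u := fun v q hv e =>
    hu' (e ▸ hv.subset List.mem_cons_self)
  have hdn : ∀ d, st d = .done → d ≠ u := fun d hd e => by rw [e, hu] at hd; cases hd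
  refine ⟨List.nodup_cons.2 ⟨hu', h.nodup⟩, hup, ?_, ?_, ?_, ?_, ?_, ?_, h.not_colorable⟩
  · intro v q hv
    rcases List.suffix_cons_iff.1 hv with e | e
    · obtain ⟨rfl, rfl⟩ := List.cons.inj e
      simp [hst]
    · have := e.length_le
      rw [List.length_cons] at this
      rw [hst, if_neg (hne v q e), h.active v q e, Function.update_of_ne (hne v q e)]
      simp only [List.length_cons, lower]
      congr 1
      symm
      rw [decide_eq_false_iff_not]
      omega
  · intro v hv
    rw [List.mem_cons, not_or] at hv
    rw [hst, if_neg hv.1]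
    rcases h.inactive v hv.2 with e | e <;> simp [e, lower]
  · intro d w hd hdw hw
    exact h.closed d w ((hdone d).1 hd) hdw (hunv w hw)
  · intro v q hv
    rcases List.suffix_cons_iff.1 hv with e | e
    · obtain ⟨rfl, rfl⟩ := List.cons.inj e
      simp
    · rw [Function.update_of_ne (hne v q e)]
      exact h.level v q e
  · intro d w hd hdw
    rw [hdone] at hd
    rw [Function.update_of_ne (hdn d hd), Function.update_of_ne]
    · exact h.level_ne d w hd hdw
    · rintro rfl
      exact h.closed d w hd hdw hu
  · intro hf c
    have key : (∀ v q, (v :: q) <:+ u :: p → window c (v :: q) ∈ Function.update S u Set.univ v) ↔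
        ∀ v q, (v :: q) <:+ p → window c (v :: q) ∈ S v := by
      refine ⟨fun H v q hv => ?_, fun H v q hv => ?_⟩
      · simpa [Function.update_of_ne (hne v q hv)] using
          H v q (hv.trans (List.suffix_cons _ _))
      · rcases List.suffix_cons_iff.1 hv with e | e
        · obtain ⟨rfl, rfl⟩ := List.cons.inj e
          simp
        · rw [Function.update_of_ne (hne v q e)]
          exact H v q e
    rw [key, h.ext hf c]
    constructor
    · rintro ⟨c', hc', hp⟩
      refine ⟨Function.update c' u (c u), fun v hv => ?_, fun d hd => ?_⟩
      · by_cases e : v = u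
        · rw [e, Function.update_self]
        · rw [Function.update_of_ne e]
          exact hc' v ((List.mem_cons.1 hv).resolve_left e)
      · rw [hdone] at hd
        rw [Function.update_of_ne (hdn d hd)]
        refine ⟨(hp d hd).1, fun w hw => ?_⟩
        rw [Function.update_of_ne]
        · exact (hp d hd).2 w hw
        · rintro rfl
          exact h.closed d w hd hw hu
    · rintro ⟨c', hc', hp⟩
      exact ⟨c', fun v hv => hc' v (List.mem_cons_of_mem _ hv),
        fun d hd => hp d ((hdone d).2 hd)⟩

/-- The colourings of the rest of the path that extend to its last vertex and the finished
vertices. -/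
theorem extendable_iff (h : Inv G k st fail p S lv) (hG : ∀ s p, IsCycleSeq G s p → s < r)
    {v : V} {q : List V} (hp : p = v :: q) (hv : ∀ w, G.Adj v w → st w ≠ .unvisited)
    (hf : ¬ fail) {st' : V → Status r} (hdone : ∀ d, st' d = .done ↔ d = v ∨ st d = .done)
    (c : V → Fin r) :
    (window c q ∈ extendable k (Set.range (info G st v)) q.length (S v) ∧
      ∀ w q', (w :: q') <:+ q → window c (w :: q') ∈ S w) ↔
    ∃ c', (∀ w ∈ q, c' w = c w) ∧ ProperOnDone G k st' c' := by
  subst hp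
  have hvq : v ∉ q := (List.nodup_cons.1 h.nodup).1
  have hne : ∀ w ∈ q, w ≠ v := fun w hw e => hvq (e ▸ hw)
  -- By the level gap, the window still shows the colour of every path neighbour of `v`.
  have hwin : ∀ w q', (w :: q') <:+ q → G.Adj v w →
      window c q (q'.length : ZMod r) = c w := fun w q' hw hvw => by
    have := level_gap hG h.nodup h.chain hw hvw
    exact window_apply hw (by omega)
  constructor
  · rintro ⟨⟨x, hx, hxS, hxN⟩, hS⟩
    have hc₁ : ∀ w ∈ q, Function.update c v x w = c w :=
      fun w hw => Function.update_of_ne (hne w hw) _ _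
    -- Give `v` the witness colour `x`; the old invariant then extends this colouring to the
    -- finished vertices.
    obtain ⟨c', hc', hd⟩ := (h.ext hf (Function.update c v x)).1 <| by
      intro w q' hw
      rcases List.suffix_cons_iff.1 hw with e | e
      · obtain ⟨rfl, rfl⟩ := List.cons.inj e
        rwa [window, window_congr hc₁, Function.update_self]
      · rw [window_congr fun y hy => hc₁ y (e.subset hy)]
        exact hS w q' e
    have hc'v : c' v = x := by rw [hc' v List.mem_cons_self, Function.update_self]
    have hc'q : ∀ w ∈ q, c' w = c w := fun w hw => by
      rw [hc' w (List.mem_cons_of_mem _ hw), hc₁ w hw]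
    refine ⟨c', hc'q, fun d hd' => ?_⟩
    rcases (hdone d).1 hd' with rfl | hd'
    · refine ⟨by rwa [hc'v], fun w hw => ?_⟩
      rcases hs : st w with _ | _ | ⟨l, t, S'⟩
      · exact absurd hs (hv w hw)
      · exact ((hd w hs).2 d hw.symm).symm
      · obtain ⟨q', hq', hl, -, -⟩ := h.exists_of_active_adj rfl hs hw.symm
        have := hxN l t S' false (mem_range_info.2
          ⟨w, hs, by simpa using hw.ne', by simpa using hw.symm⟩)
        rw [hl, hwin w q' hq' hw] at this
        rw [hc'v, hc'q w (hq'.subset List.mem_cons_self)]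
        exact this.symm
    · exact hd d hd'
  · rintro ⟨c', hc', hd⟩
    have hw : ∀ q', q' <:+ q → window c' q' = window c q' :=
      fun q' h' => window_congr fun w hw => hc' w (h'.subset hw)
    have H := (h.ext hf c').2 ⟨c', fun _ _ => rfl, fun d hd' => hd d ((hdone d).2 (Or.inr hd'))⟩
    have hdv := hd v ((hdone v).2 (Or.inl rfl))
    refine ⟨⟨c' v, hdv.1, ?_, ?_⟩, fun w q' hq' => ?_⟩
    · have := H v q List.suffix_rfl
      rwa [window, hw q List.suffix_rfl] at this
    · intro i t S' fo hi
      obtain ⟨w, hs, -, hwv⟩ := mem_range_info.1 hi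
      have hwv := hwv.2 rfl
      obtain ⟨q', hq', rfl, -, -⟩ := h.exists_of_active_adj rfl hs hwv
      rw [hwin w q' hq' hwv.symm, ← hc' w (hq'.subset List.mem_cons_self)]
      exact (hdv.2 w hwv.symm).symm
    · rw [← hw _ hq']
      exact H w q' (hq'.trans (List.suffix_cons _ _))

/-- By `extendable_iff`, finishing `v` adds just the constraint `T` on the window of `q`. The
parent, which is the head of `q`, absorbs it. A root has no parent, and `T` then only settles
whether its component is colourable. -/
theorem pop (h : Inv G k st fail p S lv) (hG : ∀ s p, IsCycleSeq G s p → s < r)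
    {v : V} {q : List V} (hp : p = v :: q) (hv : ∀ w, G.Adj v w → st w ≠ .unvisited)
    {T : Set (ZMod r → Fin r)}
    (hT : T = extendable k (Set.range (info G st v)) q.length (S v))
    {st' : V → Status r} {fail' : Prop}
    (hst : ∀ w, st' w = if w = v then .done else if q.head? = some w then
      .active ((q.length : ZMod r) - 1) true (S w ∩ T) else st w)
    (hfail : fail' ↔ fail ∨ q = [] ∧ (fun _ => 0) ∉ T) :
    Inv G k st' fail' q (fun w => if q.head? = some w then S w ∩ T else S w) lv := by
  have hvp : v ∈ p := hp ▸ List.mem_cons_self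
  have hvq : v ∉ q := (List.nodup_cons.1 (hp ▸ h.nodup)).1
  have hsuf : ∀ {w q'}, (w :: q') <:+ q → (w :: q') <:+ p := fun hw =>
    hp ▸ hw.trans (List.suffix_cons _ _)
  have hhead : ∀ w, q.head? = some w → w ∈ q := fun w hw => List.mem_of_mem_head? hw
  have hdone : ∀ d, st' d = .done ↔ d = v ∨ st d = .done := by
    intro d
    rw [hst]
    split_ifs with h₁ h₂
    · simp [h₁]
    · have : st d ≠ .done := fun e => h.notMem_of_done e (hp ▸ List.mem_cons_of_mem _ (hhead d h₂))
      simp [h₁, this]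
    · simp [h₁]
  have hunv : ∀ d, st' d = .unvisited → st d = .unvisited := by
    intro d
    rw [hst]
    split_ifs <;> simp
  have hlv : lv v = (q.length : ZMod r) := h.level v q (hp ▸ List.suffix_rfl)
  -- For empty `q` nobody stores `T`, so the constraint has to hold outright; otherwise `fail'` is
  -- raised.
  have key : ∀ c : V → Fin r, (q = [] → (fun _ => 0) ∈ T) →
      ((∀ w q', (w :: q') <:+ q →
        window c (w :: q') ∈ if q.head? = some w then S w ∩ T else S w) ↔
      (window c q ∈ T ∧ ∀ w q', (w :: q') <:+ q → window c (w :: q') ∈ S w)) := by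
    intro c h0
    constructor
    · intro H
      refine ⟨?_, fun w q' hw => ?_⟩
      · rcases q with _ | ⟨u, q₂⟩
        · exact h0 rfl
        · have := H u q₂ List.suffix_rfl
          simp only [List.head?_cons, if_true] at this
          exact this.2
      · have := H w q' hw
        split_ifs at this
        · exact this.1
        · exact this
    · rintro ⟨hT', H⟩ w q' hw
      split_ifs with hh
      · refine ⟨H w q' hw, ?_⟩
        suffices e : w :: q' = q by rwa [e]
        rcases q with _ | ⟨u, q₂⟩
        · simp at hh
        · simp only [List.head?_cons, Option.some.injEq] at hh
          subst hh
          rcases List.suffix_cons_iff.1 hw with e | e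
          · exact e
          · have := (List.nodup_cons.1 (List.nodup_cons.1 (hp ▸ h.nodup)).2).1
            exact absurd (e.subset List.mem_cons_self) this
      · exact H w q' hw
  refine ⟨(List.nodup_cons.1 (hp ▸ h.nodup)).2, (hp ▸ h.chain).tail, ?_, ?_, ?_, ?_, ?_, ?_, ?_⟩
  · intro w q' hw
    have hwv : w ≠ v := fun e => hvq (e ▸ hw.subset List.mem_cons_self)
    rw [hst, if_neg hwv]
    split_ifs with hh
    · rcases q with _ | ⟨u, q₂⟩
      · simp at hh
      · simp only [List.head?_cons, Option.some.injEq] at hh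
        subst hh
        have e : u :: q' = u :: q₂ := by
          rcases List.suffix_cons_iff.1 hw with e | e
          · exact e
          · have := (List.nodup_cons.1 (List.nodup_cons.1 (hp ▸ h.nodup)).2).1
            exact absurd (e.subset List.mem_cons_self) this
        obtain ⟨-, rfl⟩ := List.cons.inj e
        simp
    · rw [h.active w q' (hsuf hw)]
      congr 1
      have hl := hw.length_le
      rw [hp]
      rw [List.length_cons] at hl ⊢
      rw [decide_eq_decide]
      refine ⟨fun _ => by omega, fun e => absurd ?_ hh⟩
      rw [← hw.eq_of_length e]
      rfl
  · intro w hw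
    rw [hst]
    split_ifs with h₁ h₂
    · exact Or.inr rfl
    · exact absurd (hhead w h₂) hw
    · exact h.inactive w (by rw [hp, List.mem_cons, not_or]; exact ⟨h₁, hw⟩)
  · intro d w hd hdw hw
    rcases (hdone d).1 hd with rfl | hd
    · exact hv w hdw (hunv w hw)
    · exact h.closed d w hd hdw (hunv w hw)
  · exact fun w q' hw => h.level w q' (hsuf hw)
  · intro d w hd hdw
    rcases (hdone d).1 hd with rfl | hd
    · rcases hs : st w with _ | _ | ⟨l, t, S'⟩
      · exact absurd hs (hv w hdw)
      · exact (h.level_ne w d hs hdw.symm).symm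
      · obtain ⟨q', hq', hl, -, -⟩ := h.exists_of_active_adj hp hs hdw.symm
        rw [hlv, h.level w q' (hsuf hq')]
        intro e
        have h₁ := level_gap hG (hp ▸ h.nodup) (hp ▸ h.chain) hq' hdw
        have h₂ := hq'.length_le
        rw [List.length_cons] at h₂
        have := natCast_inj_of_lt e.symm (by omega) (by omega)
        omega
    · exact h.level_ne d w hd hdw
  · intro hf c
    rw [hfail, not_or] at hf
    rw [key c fun e => by by_contra h0; exact hf.2 ⟨e, h0⟩, hT]
    exact h.extendable_iff hG hp hv hf.1 hdone c
  · intro hf ⟨c, hc⟩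
    rw [hfail] at hf
    by_cases hf' : fail
    · exact h.not_colorable hf' ⟨c, hc⟩
    · obtain ⟨hq, h0⟩ := hf.resolve_left hf'
      have := (h.extendable_iff hG hp hv hf' hdone c).2 ⟨c, fun _ _ => rfl, fun d _ => hc d⟩
      rw [← hT, hq] at this
      exact h0 this.1

/-- The level is determined by the path, so the choice made in `next` is forced. -/
theorem of_isPush (h : Inv G k st fail p S lv) {v : V} {l : ZMod r}
    (hl : IsPush (Set.range (info G st v)) l) :
    st v = .unvisited ∧ (v :: p).IsChain G.Adj ∧ l = p.length := by
  obtain ⟨⟨b, hb⟩, hl⟩ := hl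
  obtain ⟨j, hj, hjv, -⟩ := mem_range_info.1 hb
  obtain rfl := hjv.2 rfl
  refine ⟨hj, ?_⟩
  rcases hl with ⟨l', S', f, hm, rfl⟩ | ⟨hn, rfl⟩
  · obtain ⟨t, ht, -, htj⟩ := mem_range_info.1 hm
    obtain ⟨q, -, rfl, hq, -⟩ := h.exists_of_active ht
    rw [← hq.1 rfl]
    refine ⟨List.IsChain.cons_cons (htj.2 rfl).symm ?_, by simp⟩
    rw [hq.1 rfl]
    exact h.chain
  · rcases p with _ | ⟨t, q⟩
    · simp
    · have ht := h.active t q List.suffix_rfl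
      simp only [List.length_cons, decide_true] at ht
      exact absurd (mem_range_info.2 ⟨t, ht, by simp, by simp⟩)
        (hn q.length (S t) (decide (t = j)) (decide (G.Adj t j)))

theorem of_isPop (h : Inv G k st fail p S lv) {v : V} {l : ZMod r} {S' : Set (ZMod r → Fin r)}
    (hl : IsPop (Set.range (info G st v)) l S') :
    ∃ q, p = v :: q ∧ l = q.length ∧ S' = S v ∧ ∀ w, G.Adj v w → st w ≠ .unvisited := by
  obtain ⟨⟨b, hb⟩, hl⟩ := hl
  obtain ⟨j, hj, hjv, -⟩ := mem_range_info.1 hb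
  obtain rfl := hjv.2 rfl
  obtain ⟨q, -, rfl, hq, rfl⟩ := h.exists_of_active hj
  refine ⟨q, (hq.1 rfl).symm, rfl, rfl, fun w hw hs => hl false (mem_range_info.2 ⟨w, hs, ?_, ?_⟩)⟩
  · simpa using hw.ne'
  · simpa using hw.symm

end Inv

/-! ### Progress and outcome of the search. -/

/-- The number of times that a vertex is still to be appended to or removed from the search
path. -/
def weight : Status r → ℕ
  | .unvisited => 2
  | .active _ _ _ => 1
  | .done => 0

theorem weight_lower (s : Status r) : weight (lower s) = weight s := by
  cases s <;> rfl

section Round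

variable [NeZero r] {G : SimpleGraph V} {k : ℕ} {st : V → Status r} {fail : Prop}

/-- The invariant of the depth-first search, for some search path. -/
def Valid (G : SimpleGraph V) (k : ℕ) (st : V → Status r) (fail : Prop) : Prop :=
  ∃ p S lv, Inv G k st fail p S lv

theorem valid_init (G : SimpleGraph V) (k : ℕ) :
    Valid G k (fun _ => (.unvisited : Status r)) False := by
  refine ⟨[], fun _ => Set.univ, fun _ => 0, by simp, by simp, by simp, by simp, by simp, by simp,
    by simp, fun _ c => ?_, by simp⟩
  simp [ProperOnDone]

/-- The search after a look at the vertex `v`. -/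
noncomputable def step (G : SimpleGraph V) (k : ℕ) (st : V → Status r) (v : V) : V → Status r :=
  fun j => next k (Set.range (info G st v)) (info G st v j)

theorem valid_step_push (h : Valid G k st fail) {v : V} {l : ZMod r}
    (hl : IsPush (Set.range (info G st v)) l) :
    Valid G k (step G k st v) (fail ∨ Fails k (Set.range (info G st v))) ∧
      (∀ w, weight (step G k st v w) ≤ weight (st w)) ∧
      weight (step G k st v v) < weight (st v) := by
  obtain ⟨p, S, lv, h⟩ := h
  have hex : ∃ l, IsPush (Set.range (info G st v)) l := ⟨l, hl⟩
  have hc := (h.of_isPush hex.choose_spec).2.2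
  obtain ⟨hv, hp, -⟩ := h.of_isPush hl
  have hst : ∀ w, step G k st v w =
      if w = v then .active p.length true Set.univ else lower (st w) := by
    intro w
    rw [step, next, dif_pos hex, hc]
    simp [info]
  have hF : ¬ Fails k (Set.range (info G st v)) := by
    rintro ⟨l, S', hl, -⟩
    obtain ⟨q, hq, -⟩ := h.of_isPop hl
    exact h.notMem_of_unvisited hv (hq ▸ List.mem_cons_self)
  simp only [hF, or_false]
  refine ⟨⟨_, _, _, h.push hv hp hst⟩, fun w => ?_, ?_⟩
  · rw [hst]
    split_ifs with hw
    · rw [hw, hv]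
      simp [weight]
    · rw [weight_lower]
  · rw [hst, if_pos rfl, hv]
    simp [weight]

theorem valid_step_pop (hG : ∀ s p, IsCycleSeq G s p → s < r) (h : Valid G k st fail) {v : V}
    {l : ZMod r} {S' : Set (ZMod r → Fin r)} (hl : IsPop (Set.range (info G st v)) l S') :
    Valid G k (step G k st v) (fail ∨ Fails k (Set.range (info G st v))) ∧
      (∀ w, weight (step G k st v w) ≤ weight (st w)) ∧
      weight (step G k st v v) < weight (st v) := by
  obtain ⟨p, S, lv, h⟩ := h
  have hex : ∃ y : ZMod r × Set (ZMod r → Fin r), IsPop (Set.range (info G st v)) y.1 y.2 :=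
    ⟨(l, S'), hl⟩
  obtain ⟨q, rfl, rfl, rfl, hv⟩ := h.of_isPop hl
  obtain ⟨q', hq', hc₁, hc₂, -⟩ := h.of_isPop hex.choose_spec
  obtain ⟨-, rfl⟩ := List.cons.inj hq'
  have hn : ¬ ∃ l, IsPush (Set.range (info G st v)) l := by
    rintro ⟨l, hl⟩
    exact h.notMem_of_unvisited (h.of_isPush hl).1 List.mem_cons_self
  have hsv := h.active v q List.suffix_rfl
  have hadj : ∀ w, q.head? = some w → G.Adj w v := by
    intro w hw
    rcases q with _ | ⟨u, q₂⟩
    · simp at hw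
    · simp only [List.head?_cons, Option.some.injEq] at hw
      subst hw
      exact (List.isChain_cons_cons.1 h.chain).1.symm
  set T := extendable k (Set.range (info G st v)) q.length (S v) with hT
  have hst : ∀ w, step G k st v w = if w = v then .done else if q.head? = some w then
      .active ((q.length : ZMod r) - 1) true (S w ∩ T) else st w := by
    intro w
    rw [step, next, dif_neg hn, dif_pos hex, hc₁, hc₂, ← hT]
    simp only [info, decide_eq_true_eq]
    by_cases hw : w = v
    · rw [if_pos hw, if_pos hw]
    rw [if_neg hw, if_neg hw]
    by_cases hh : q.head? = some w
    · rw [if_pos hh, if_pos (hadj w hh)]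
      rcases q with _ | ⟨u, q₂⟩
      · simp at hh
      · simp only [List.head?_cons, Option.some.injEq] at hh
        subst hh
        rw [h.active u q₂ (List.suffix_cons _ _)]
        simp [raise]
    · rw [if_neg hh]
      split_ifs with ha
      · rcases hs : st w with _ | _ | ⟨l, t, S'⟩
        · rfl
        · rfl
        -- By `level_gap`, a path neighbour whose level is congruent to that of the parent is the
        -- parent itself, so `raise` changes no other vertex.
        · rw [raise, if_neg]
          obtain ⟨q', hq', rfl, -, -⟩ := h.exists_of_active_adj rfl hs ha
          intro e
          have h₁ := level_gap hG h.nodup h.chain hq' ha.symm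
          have h₂ := hq'.length_le
          rw [List.length_cons] at h₂
          have h₃ := natCast_inj_of_lt (a := q'.length + 1) (b := q.length) (r := r)
            (by rw [← e]; push_cast; rfl) (by omega) (by omega)
          rw [← hq'.eq_of_length h₃] at hh
          exact hh rfl
      · rfl
  have hfail : fail ∨ Fails k (Set.range (info G st v)) ↔
      fail ∨ q = [] ∧ (fun _ => 0) ∉ T := by
    refine or_congr_right ?_
    constructor
    · rintro ⟨l, S', hl, hN, h0⟩
      obtain ⟨q', hq', rfl, rfl, -⟩ := h.of_isPop hl
      obtain ⟨-, rfl⟩ := List.cons.inj hq'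
      refine ⟨?_, h0⟩
      rcases q with _ | ⟨u, q₂⟩
      · rfl
      · refine absurd ?_ (hN q₂.length _ (S u) (decide (u = v))
          (mem_range_info.2 ⟨u, h.active u q₂ (List.suffix_cons _ _), by simp, ?_⟩))
        · simp
        · simpa using hadj u rfl
    · rintro ⟨rfl, h0⟩
      refine ⟨_, _, hl, fun l' t S' f hm => ?_, h0⟩
      obtain ⟨w, hs, -, hw⟩ := mem_range_info.1 hm
      obtain ⟨q', hq', -⟩ := h.exists_of_active_adj rfl hs (hw.2 rfl)
      simp at hq'
  refine ⟨⟨_, _, _, h.pop hG rfl hv hT hst hfail⟩, fun w => ?_, ?_⟩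
  · rw [hst]
    split_ifs with h₁ h₂
    · simp [weight]
    · obtain ⟨q', hq'⟩ := exists_suffix_of_mem (List.mem_cons_of_mem v (List.mem_of_mem_head? h₂))
      rw [h.active w q' hq']
      simp [weight]
    · exact le_rfl
  · rw [hst, if_pos rfl, hsv]
    simp [weight]

theorem valid_step (hG : ∀ s p, IsCycleSeq G s p → s < r) (h : Valid G k st fail) {v : V}
    (he : Enabled (Set.range (info G st v))) :
    Valid G k (step G k st v) (fail ∨ Fails k (Set.range (info G st v))) ∧
      (∀ w, weight (step G k st v w) ≤ weight (st w)) ∧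
      weight (step G k st v v) < weight (st v) := by
  rcases he with ⟨l, hl⟩ | ⟨l, S, hl⟩
  · exact valid_step_push h hl
  · exact valid_step_pop hG h hl

/-- If the path is empty, an unvisited vertex can become a root. Otherwise the tip has an unvisited
neighbour to append, or can itself be removed. -/
theorem exists_enabled (h : Valid G k st fail) {v : V}
    (hv : st v = .unvisited ∨ ∃ l S, st v = .active l true S) :
    ∃ u, Enabled (Set.range (info G st u)) := by
  obtain ⟨p, S, lv, h⟩ := h
  rcases p with _ | ⟨t, q⟩
  · have hv' : st v = .unvisited := hv.resolve_right fun ⟨l, S', hs⟩ => by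
      obtain ⟨q, hq, -⟩ := h.exists_of_active hs
      simp at hq
    refine ⟨v, Or.inl ⟨0, ⟨false, mem_range_info.2 ⟨v, hv', by simp, by simp⟩⟩, Or.inr ⟨?_, rfl⟩⟩⟩
    intro l S' f b hm
    obtain ⟨w, hs, -⟩ := mem_range_info.1 hm
    obtain ⟨q, hq, -⟩ := h.exists_of_active hs
    simp at hq
  · have ht := h.active t q List.suffix_rfl
    simp only [List.length_cons, decide_true] at ht
    by_cases hw : ∃ w, st w = .unvisited ∧ G.Adj t w
    · obtain ⟨w, hw, htw⟩ := hw
      refine ⟨w, Or.inl ⟨q.length + 1, ⟨false, mem_range_info.2 ⟨w, hw, by simp, by simp⟩⟩,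
        Or.inl ⟨q.length, S t, false, mem_range_info.2 ⟨t, ht, ?_, ?_⟩, rfl⟩⟩⟩
      · simpa using htw.ne
      · simpa using htw
    · refine ⟨t, Or.inr ⟨q.length, S t, ⟨false, mem_range_info.2 ⟨t, ht, by simp, by simp⟩⟩, ?_⟩⟩
      intro f hm
      obtain ⟨w, hs, -, hwt⟩ := mem_range_info.1 hm
      exact hw ⟨w, hs, (hwt.2 rfl).symm⟩

/-- The outcome of the search. -/
theorem colorable_iff_of_finished (hk : k ≤ r) (h : Valid G k st fail)
    (hu : ∀ v, st v ≠ .unvisited) (ht : ∀ v l S, st v ≠ .active l true S) :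
    G.Colorable r ∧ (G.Colorable k ↔ ¬ fail) := by
  obtain ⟨p, S, lv, h⟩ := h
  have hp : p = [] := by
    rcases p with _ | ⟨t, q⟩
    · rfl
    · have := h.active t q List.suffix_rfl
      simp only [List.length_cons, decide_true] at this
      exact absurd this (ht _ _ _)
  subst hp
  have hd : ∀ v, st v = .done := fun v => (h.inactive v (by simp)).resolve_left (hu v)
  refine ⟨?_, ?_⟩
  · have C : G.Coloring (ZMod r) := SimpleGraph.Coloring.mk lv fun hvw => h.level_ne _ _ (hd _) hvw
    simpa [ZMod.card] using C.colorable
  · constructor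
    · rintro ⟨C⟩ hf
      refine h.not_colorable hf ⟨fun v => Fin.castLE hk (C v), fun v => ⟨(C v).2, fun w hw e => ?_⟩⟩
      exact C.valid hw (Fin.castLE_injective hk e)
    · intro hf
      -- For the empty path the left side of `ext` is vacuous.
      obtain ⟨c, -, hc⟩ := (h.ext hf fun _ => 0).1 (by simp)
      refine ⟨SimpleGraph.Coloring.mk (fun v => ⟨(c v).val, (hc v (hd v)).1⟩) fun {v w} hvw e => ?_⟩
      exact (hc v (hd v)).2 w hvw (Fin.ext (by simpa using e))

end Round

end DFS

/-! ### The sweeping machine for the search. -/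

namespace ColouringMachine

open Classical DFS Sweeper

/-- `NeZero r` is needed because `ZMod 0` is infinite. -/
instance (r : ℕ) [NeZero r] : Finite (Status r) := by
  let f : Status r → Option (Option (ZMod r × Bool × Set (ZMod r → Fin r)))
    | .unvisited => none
    | .done => some none
    | .active l t S => some (some (l, t, S))
  refine Finite.of_injective f fun s s' h => ?_
  cases s <;> cases s' <;> simp_all [f]

/-- The cells of the search table: row `j` consists of a header with the status of the vertex `j`,
a focus mark, and a bit that tells whether `j` is adjacent to the vertex in focus; and of the
entries of the `j`-th row of the adjacency matrix, with a focus mark each. -/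
inductive Cell (r : ℕ)
  | header (s : Status r) (focus adj : Bool)
  | entry (adj focus : Bool)

instance (r : ℕ) : Inhabited (Cell r) := ⟨.entry false false⟩

instance (r : ℕ) [NeZero r] : Finite (Cell r) := by
  let f : Cell r → (Status r × Bool × Bool) ⊕ (Bool × Bool)
    | .header s a b => .inl (s, a, b)
    | .entry a b => .inr (a, b)
  refine Finite.of_injective f fun s s' h => ?_
  cases s <;> cases s' <;> simp_all [f]

/-- The control states. -/
structure Ctrl (r : ℕ) where
  /-- the number of colours, cut off at `r` -/
  colours : Fin (r + 1)
  /-- the place value of the next binary digit of the number of colours, cut off at `r` -/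
  place : Fin (r + 1)
  /-- whether the adjacency matrix has been reached -/
  started : Bool
  /-- what has been seen in the present backward sweep -/
  seen : Set (Info r)
  /-- whether the vertex of the present row is adjacent to the vertex in focus -/
  bit : Bool
  /-- the focus mark for the next header -/
  rowCarry : Bool
  /-- the focus mark for the next entry -/
  colCarry : Bool
  /-- whether a component without colouring has been found -/
  fail : Bool

instance (r : ℕ) [NeZero r] : Finite (Ctrl r) := by
  let f : Ctrl r → Fin (r + 1) × Fin (r + 1) × Bool × Set (Info r) × Bool × Bool × Bool × Bool :=
    fun q => (q.colours, q.place, q.started, q.seen, q.bit, q.rowCarry, q.colCarry, q.fail)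
  refine Finite.of_injective f fun s s' h => ?_
  cases s
  cases s'
  simp_all [f]

/-- A number, cut off at `r`. -/
def cutoff (r x : ℕ) : Fin (r + 1) := ⟨min r x, by omega⟩

/-- No vertex is in focus. -/
def NoFocus {r : ℕ} (g : Set (Info r)) : Prop := ∀ s b, (s, true, b) ∉ g

/-- The machine that decides colourability by depth-first search. In the course of a round, the
focus moves to the next vertex; after the last vertex, it is on no vertex for one round. -/
noncomputable def machine (r : ℕ) [NeZero r] : Sweeper (Option Bool) (Ctrl r) (Cell r) where
  -- `rowCarry = true` puts the initial focus on row 0; while reading, each header sets `colCarry`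
  -- and so marks column 0.
  init := ⟨cutoff r 0, cutoff r 1, false, ∅, false, true, false, false⟩
  read q
    | none => ({ q with started := true, rowCarry := false, colCarry := true },
        some (.header .unvisited q.rowCarry false))
    | some b =>
      if q.started then ({ q with colCarry := false }, some (.entry b q.colCarry))
      else ({ q with
        colours := cutoff r (q.colours + if b then q.place.val else 0)
        place := cutoff r (2 * q.place) }, none)
  -- A backward sweep meets the entries of a row before its header, so the adjacency bit is ready at
  -- the header.
  back q
    | .header s f _ =>
      ({ q with seen := insert (s, f, q.bit) q.seen, bit := false }, .header s f q.bit)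
    | .entry a m => ({ q with bit := q.bit || (m && a) }, .entry a m)
  turn q := { q with
    fail := q.fail || decide (Fails q.colours.val q.seen)
    rowCarry := decide (NoFocus q.seen) }
  verdict q := if Finished q.seen then some (!q.fail) else none
  -- The carries hand each mark on to the next header or entry. A mark on the last one falls off; a
  -- round later `NoFocus` makes it reappear in first place.
  forth q
    | .header s f b =>
      ({ q with rowCarry := f, colCarry := decide (NoFocus q.seen) },
        .header (next q.colours.val q.seen (s, f, b)) q.rowCarry false)
    | .entry a m => ({ q with colCarry := m }, .entry a q.colCarry)
  restart q := { q with seen := ∅, bit := false }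

/-! ### The effect of sweeps on the table. -/

section Table

variable {r : ℕ}

/-- The entries `i, …, i + len - 1` of a row `a` of the matrix, with the focus on column `v`. -/
def entries (a : ℕ → Bool) (v i len : ℕ) : List (Cell r) :=
  (List.range' i len).map fun i => .entry (a i) (i == v)

/-- The rows `i, …, i + len - 1` of the table, with the focus on the vertex `v`. -/
def rows (n : ℕ) (a : ℕ → ℕ → Bool) (s : ℕ → Status r) (t : ℕ → Bool) (v i len : ℕ) :
    List (Cell r) :=
  (List.range' i len).flatMap fun j => .header (s j) (j == v) (t j) :: entries (a j) v 0 n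

theorem entries_succ (a : ℕ → Bool) (v i len : ℕ) :
    (entries a v i (len + 1) : List (Cell r)) = .entry (a i) (i == v) :: entries a v (i + 1) len :=
  rfl

theorem rows_succ (n : ℕ) (a : ℕ → ℕ → Bool) (s : ℕ → Status r) (t : ℕ → Bool) (v i len : ℕ) :
    rows n a s t v i (len + 1) =
      .header (s i) (i == v) (t i) :: (entries (a i) v 0 n ++ rows n a s t v (i + 1) len) :=
  rfl

theorem rows_congr {n : ℕ} {a : ℕ → ℕ → Bool} {s s' : ℕ → Status r} {t : ℕ → Bool} {v i len : ℕ}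
    (h : ∀ j, j < i + len → s j = s' j) : rows n a s t v i len = rows n a s' t v i len := by
  unfold rows
  refine List.flatMap_congr fun j hj => ?_
  rw [h j (by rw [List.mem_range'_1] at hj; exact hj.2)]

variable [NeZero r]

theorem back_entries (a : ℕ → Bool) (v i len : ℕ) (q : Ctrl r) (acc : List (Cell r)) :
    sweep (machine r).back q (entries a v i len).reverse acc =
      ({ q with bit := q.bit || (decide (i ≤ v ∧ v < i + len) && a v) },
        entries a v i len ++ acc) := by
  induction len generalizing i with
  | zero =>
    have h : ¬ (i ≤ v ∧ v < i + 0) := by omega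
    rw [decide_eq_false h, Bool.false_and, Bool.or_false]
    rfl
  | succ len ih =>
    rw [entries_succ, List.reverse_cons, sweep_append, ih]
    simp only [sweep, machine, List.cons_append, Prod.mk.injEq, and_true, Ctrl.mk.injEq, true_and]
    rw [Bool.or_assoc]
    congr 1
    rcases lt_trichotomy i v with h | rfl | h
    · have h₁ : (i + 1 ≤ v ∧ v < i + 1 + len) ↔ (i ≤ v ∧ v < i + (len + 1)) := by omega
      rw [decide_eq_decide.2 h₁, beq_eq_false_iff_ne.2 h.ne, Bool.false_and, Bool.or_false]
    · simp
    · have h₁ : ¬ (i + 1 ≤ v ∧ v < i + 1 + len) := by omega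
      have h₂ : ¬ (i ≤ v ∧ v < i + (len + 1)) := by omega
      rw [decide_eq_false h₁, decide_eq_false h₂, beq_eq_false_iff_ne.2 h.ne']
      rfl

/-- `ha` covers the position `v = n`, where no vertex is in focus and there is no column to read. -/
theorem back_rows {n : ℕ} {a : ℕ → ℕ → Bool} (s : ℕ → Status r) (t : ℕ → Bool) {v : ℕ}
    (ha : ∀ j, n ≤ v → a j v = false) (i len : ℕ) {q : Ctrl r} (hq : q.bit = false)
    (acc : List (Cell r)) :
    sweep (machine r).back q (rows n a s t v i len).reverse acc =
      ({ q with seen := q.seen ∪ {x | ∃ j, i ≤ j ∧ j < i + len ∧ x = (s j, j == v, a j v)} },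
        rows n a s (fun j => a j v) v i len ++ acc) := by
  induction len generalizing i with
  | zero =>
    have : {x : Info r | ∃ j, i ≤ j ∧ j < i + 0 ∧ x = (s j, j == v, a j v)} = ∅ := by
      refine Set.eq_empty_of_forall_notMem ?_
      rintro x ⟨j, h₁, h₂, -⟩
      omega
    simp only [this, Set.union_empty]
    rfl
  | succ len ih =>
    have hbit : (decide (0 ≤ v ∧ v < 0 + n) && a i v) = a i v := by
      by_cases hv : v < n
      · simp [hv]
      · simp [ha i (by omega)]
    rw [rows_succ, List.reverse_cons, List.reverse_append, sweep_append, sweep_append, ih,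
      back_entries, hbit, rows_succ]
    simp only [sweep, machine, hq, Bool.false_or, List.cons_append, List.append_assoc,
      Prod.mk.injEq, and_true, Ctrl.mk.injEq, true_and]
    ext x
    simp only [Set.mem_insert_iff, Set.mem_union, Set.mem_ofPred_eq]
    constructor
    · rintro (rfl | h | ⟨j, h₁, h₂, rfl⟩)
      · exact Or.inr ⟨i, le_rfl, by omega, rfl⟩
      · exact Or.inl h
      · exact Or.inr ⟨j, by omega, by omega, rfl⟩
    · rintro (h | ⟨j, h₁, h₂, rfl⟩)
      · exact Or.inr (Or.inl h)
      · rcases h₁.eq_or_lt with rfl | h₁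
        · exact Or.inl rfl
        · exact Or.inr (Or.inr ⟨j, h₁, by omega, rfl⟩)

/-- The successor of a focus position. -/
def nextFocus (n v : ℕ) : ℕ := if v = n then 0 else v + 1

/-- This is why a single carried bit moves the focus: the new mark at `i + 1` is the old one at `i`.
-/
theorem succ_beq_nextFocus {n v i : ℕ} (hi : i < n) : (i + 1 == nextFocus n v) = (i == v) := by
  have h : (i + 1 = if v = n then 0 else v + 1) ↔ i = v := by
    by_cases hv : v = n
    · rw [if_pos hv]
      omega
    · rw [if_neg hv]
      omega
  rw [Bool.eq_iff_iff, beq_iff_eq, beq_iff_eq, nextFocus, h]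

theorem forth_entries {n : ℕ} (a : ℕ → Bool) (v i len : ℕ) (h : i + len ≤ n) {q : Ctrl r}
    (hq : q.colCarry = (i == nextFocus n v)) (acc : List (Cell r)) :
    sweep (machine r).forth q (entries a v i len) acc =
      ({ q with colCarry := (i + len == nextFocus n v) },
        (entries a (nextFocus n v) i len).reverse ++ acc) := by
  induction len generalizing i q acc with
  | zero =>
    rw [add_zero, ← hq]
    rfl
  | succ len ih =>
    rw [entries_succ, sweep]
    simp only [machine] at ih ⊢
    rw [ih (i + 1) (by omega) (succ_beq_nextFocus (by omega)).symm, entries_succ]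
    simp only [hq, List.reverse_cons, List.append_assoc, List.cons_append, List.nil_append]
    rw [show i + 1 + len = i + (len + 1) by omega]

theorem forth_rows {n : ℕ} (a : ℕ → ℕ → Bool) (s : ℕ → Status r) (t : ℕ → Bool) (v i len : ℕ)
    (h : i + len ≤ n) {q : Ctrl r} (hr : q.rowCarry = (i == nextFocus n v))
    (hg : decide (NoFocus q.seen) = (0 == nextFocus n v)) (acc : List (Cell r)) :
    ∃ b b', sweep (machine r).forth q (rows n a s t v i len) acc =
      ({ q with rowCarry := b, colCarry := b' },
        (rows n a (fun j => next q.colours.val q.seen (s j, j == v, t j)) (fun _ => false)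
          (nextFocus n v) i len).reverse ++ acc) := by
  induction len generalizing i q acc with
  | zero => exact ⟨q.rowCarry, q.colCarry, rfl⟩
  | succ len ih =>
    have hstep : (machine r).forth q (.header (s i) (i == v) (t i)) =
      ({ q with rowCarry := (i == v), colCarry := (0 == nextFocus n v) },
        .header (next q.colours.val q.seen (s i, i == v, t i)) (i == nextFocus n v) false) := by
      simp only [machine, hg, hr]
    rw [rows_succ, sweep, hstep, sweep_append, forth_entries (n := n) _ _ _ _ (by omega) rfl]
    obtain ⟨b, b', e⟩ := ih (i + 1) (by omega)
      (q := { q with rowCarry := (i == v), colCarry := (0 + n == nextFocus n v) })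
      (succ_beq_nextFocus (by omega)).symm hg
      ((entries (a i) (nextFocus n v) 0 n).reverse ++
        .header (next q.colours.val q.seen (s i, i == v, t i)) (i == nextFocus n v) false :: acc)
    refine ⟨b, b', e.trans ?_⟩
    rw [rows_succ]
    simp

end Table

/-! ### Rounds of the machine as steps of the search. -/

section Search

variable {r n : ℕ}

/-- A labelling of `0, …, n - 1`, as a function on all natural numbers. -/
def extend (st : Fin n → Status r) (i : ℕ) : Status r :=
  if h : i < n then st ⟨i, h⟩ else .done

/-- The adjacency matrix of `G`. -/
noncomputable def matrix (G : SimpleGraph (Fin n)) (i j : ℕ) : Bool :=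
  decide (∃ (hi : i < n) (hj : j < n), G.Adj ⟨i, hi⟩ ⟨j, hj⟩)

/-- The search table for the labelling `st`, with the focus on `v`, last cell first. -/
noncomputable def table (G : SimpleGraph (Fin n)) (st : Fin n → Status r) (t : ℕ → Bool) (v : ℕ) :
    List (Cell r) :=
  (rows n (matrix G) (extend st) t v 0 n).reverse

/-- What is seen of the vertices with the focus on `v`. -/
def view (G : SimpleGraph (Fin n)) (st : Fin n → Status r) (v : ℕ) : Set (Info r) :=
  {x | ∃ j, 0 ≤ j ∧ j < 0 + n ∧ x = (extend st j, j == v, matrix G j v)}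

theorem matrix_of_le (G : SimpleGraph (Fin n)) {v : ℕ} (j : ℕ) (hv : n ≤ v) :
    matrix G j v = false := by
  refine decide_eq_false ?_
  rintro ⟨-, h, -⟩
  omega

theorem info_eq (G : SimpleGraph (Fin n)) (st : Fin n → Status r) (v j : Fin n) :
    info G st v j = (extend st j, j.val == v.val, matrix G j v) := by
  simp only [info, extend, matrix, Fin.is_lt, dif_pos, Prod.mk.injEq, true_and, Fin.eta,
    exists_true_left, and_true]
  rw [Bool.eq_iff_iff]
  simp [Fin.ext_iff]

theorem view_eq (G : SimpleGraph (Fin n)) (st : Fin n → Status r) (v : Fin n) :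
    view G st v = Set.range (info G st v) := by
  ext x
  simp only [view, Set.mem_ofPred_eq, Set.mem_range, zero_le, zero_add, true_and, info_eq]
  constructor
  · rintro ⟨j, hj, rfl⟩
    exact ⟨⟨j, hj⟩, rfl⟩
  · rintro ⟨j, rfl⟩
    exact ⟨j, j.2, rfl⟩

theorem noFocus_view (G : SimpleGraph (Fin n)) (st : Fin n → Status r) {v : ℕ} (hv : v ≤ n) :
    decide (NoFocus (view G st v)) = (0 == nextFocus n v) := by
  have h : NoFocus (view G st v) ↔ 0 = nextFocus n v := by
    unfold nextFocus
    by_cases h : v = n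
    · rw [if_pos h]
      refine iff_of_true ?_ rfl
      rintro s b ⟨j, -, hj, e⟩
      simp only [Prod.mk.injEq] at e
      have := beq_iff_eq.1 e.2.1.symm
      omega
    · rw [if_neg h]
      refine iff_of_false (fun H => ?_) (by omega)
      exact H (extend st v) (matrix G v v) ⟨v, by omega, by omega, by simp⟩
  rw [Bool.eq_iff_iff, decide_eq_true_iff, beq_iff_eq, h]

theorem not_enabled_view (G : SimpleGraph (Fin n)) (st : Fin n → Status r) :
    ¬ Enabled (view G st n) := by
  have key : NoFocus (view G st n) := by
    have := noFocus_view G st le_rfl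
    rw [nextFocus, if_pos rfl] at this
    simpa using this
  rintro (⟨l, ⟨b, hb⟩, -⟩ | ⟨l, S, ⟨b, hb⟩, -⟩)
  · exact key _ _ hb
  · exact key _ _ hb

theorem finished_view (G : SimpleGraph (Fin n)) (st : Fin n → Status r) (v : ℕ) :
    Finished (view G st v) ↔ ∀ u, st u ≠ .unvisited ∧ ∀ l S, st u ≠ .active l true S := by
  have hx : ∀ u : Fin n, extend st u = st u := fun u => by simp [extend]
  constructor
  · intro h u
    have hm : ∀ s, st u = s → (s, (u : ℕ) == v, matrix G u v) ∈ view G st v := by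
      rintro s rfl
      exact ⟨u, Nat.zero_le _, by have := u.2; omega, by rw [hx]⟩
    exact ⟨fun e => (h _ _).1 (hm _ e), fun l S e => (h _ _).2 l S (hm _ e)⟩
  · intro h f b
    refine ⟨?_, fun l S => ?_⟩
    · rintro ⟨j, -, hj, e⟩
      rw [zero_add] at hj
      have e' := congrArg Prod.fst e
      rw [hx ⟨j, hj⟩] at e'
      exact (h ⟨j, hj⟩).1 e'.symm
    · rintro ⟨j, -, hj, e⟩
      rw [zero_add] at hj
      have e' := congrArg Prod.fst e
      rw [hx ⟨j, hj⟩] at e'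
      exact (h ⟨j, hj⟩).2 l S e'.symm

/-- The labelling after a round with the focus on `v`. -/
noncomputable def update (G : SimpleGraph (Fin n)) (k : ℕ) (st : Fin n → Status r) (v : ℕ)
    (j : Fin n) : Status r :=
  next k (view G st v) (st j, j.val == v, matrix G j v)

theorem update_eq_step (G : SimpleGraph (Fin n)) (k : ℕ) (st : Fin n → Status r) (v : Fin n) :
    update G k st v = step G k st v := by
  funext j
  rw [update, step, ← view_eq, info_eq]
  simp [extend]

variable [NeZero r]

theorem sweep_back_table (G : SimpleGraph (Fin n)) (st : Fin n → Status r) (t : ℕ → Bool) (v : ℕ)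
    {q : Ctrl r} (hs : q.seen = ∅) (hb : q.bit = false) :
    sweep (machine r).back q (table G st t v) [] =
      ({ q with seen := view G st v },
        rows n (matrix G) (extend st) (fun j => matrix G j v) v 0 n) := by
  rw [table, back_rows (extend st) t (fun j => matrix_of_le G j) 0 n hb, hs, Set.empty_union,
    List.append_nil]
  rfl

theorem sweep_forth_table (G : SimpleGraph (Fin n)) (st : Fin n → Status r) {v : ℕ} (hv : v ≤ n)
    {q : Ctrl r} (hs : q.seen = view G st v) (hr : q.rowCarry = decide (NoFocus q.seen)) :
    ∃ b b', sweep (machine r).forth q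
        (rows n (matrix G) (extend st) (fun j => matrix G j v) v 0 n) [] =
      ({ q with rowCarry := b, colCarry := b' },
        table G (update G q.colours st v) (fun _ => false) (nextFocus n v)) := by
  have hg := noFocus_view G st hv
  rw [← hs] at hg
  obtain ⟨b, b', e⟩ := forth_rows (n := n) (matrix G) (extend st) (fun j => matrix G j v) v 0 n
    (by omega) (hr.trans hg) hg []
  refine ⟨b, b', e.trans ?_⟩
  rw [List.append_nil, table, hs]
  congr 2
  refine rows_congr fun j hj => ?_
  rw [zero_add] at hj
  simp [extend, update, hj]

/-- The total number of steps of the search that are still to be made. -/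
def potential (st : Fin n → Status r) : ℕ := ∑ j, weight (st j)

/-- A graph all of whose cycles have length less than `r` is `r`-colourable: colour every vertex with
its level in the search tree. -/
theorem colorable_of_no_long_cycle {G : SimpleGraph (Fin n)}
    (hG : ∀ s p, IsCycleSeq G s p → s < r) : G.Colorable r := by
  suffices H : ∀ (N : ℕ) (st : Fin n → Status r) (fail : Prop), potential st = N →
      Valid G r st fail → G.Colorable r from H _ _ _ rfl (valid_init G r)
  intro N
  induction N using Nat.strong_induction_on with
  | _ N ih =>
  intro st fail hN hV
  by_cases hF : ∃ u, st u = .unvisited ∨ ∃ l S, st u = .active l true S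
  · obtain ⟨u, hu⟩ := hF
    obtain ⟨v, hv⟩ := exists_enabled hV hu
    obtain ⟨h₁, h₂, h₃⟩ := valid_step hG hV hv
    refine ih _ ?_ _ _ rfl h₁
    rw [← hN]
    exact Finset.sum_lt_sum (fun j _ => h₂ j) ⟨v, Finset.mem_univ v, h₃⟩
  · push Not at hF
    exact (colorable_iff_of_finished le_rfl hV (fun v => (hF v).1) fun v => (hF v).2).1

/-- The number of rounds until the focus reaches `e`. -/
def distance (n v e : ℕ) : ℕ := if v ≤ e then e - v else n + 1 - v + e

theorem halts_of_finished (G : SimpleGraph (Fin n)) (st : Fin n → Status r) (t : ℕ → Bool) (v : ℕ)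
    {q : Ctrl r} (hs : q.seen = ∅) (hb : q.bit = false) (hk : q.colours.val ≤ r)
    (hV : Valid G q.colours st (q.fail = true))
    (hF : ∀ u, st u ≠ .unvisited ∧ ∀ l S, st u ≠ .active l true S) :
    (machine r).Halts q (table G st t v) 0 (decide (G.Colorable q.colours)) := by
  refine .final ?_
  rw [sweep_back_table G st t v hs hb]
  have hn : ¬ Fails q.colours.val (view G st v) := by
    rintro ⟨l, S, ⟨⟨b, j, -, hj, e⟩, -⟩, -⟩
    rw [zero_add] at hj
    have e' := congrArg Prod.fst e
    simp only [extend, hj, dif_pos] at e'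
    exact (hF ⟨j, hj⟩).2 l S e'.symm
  have hc := (colorable_iff_of_finished hk hV (fun u => (hF u).1) fun u => (hF u).2).2
  simp only [machine, (finished_view G st v).2 hF, if_true, hn, decide_false, Bool.or_false,
    Option.some.injEq]
  rw [Bool.eq_iff_iff, decide_eq_true_iff, hc]
  simp

theorem halts_round (G : SimpleGraph (Fin n)) (st : Fin n → Status r) (t : ℕ → Bool) {v : ℕ}
    (hv : v ≤ n) {q : Ctrl r} (hs : q.seen = ∅) (hb : q.bit = false)
    (hF : ¬ ∀ u, st u ≠ .unvisited ∧ ∀ l S, st u ≠ .active l true S) :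
    ∃ q' : Ctrl r, q'.seen = ∅ ∧ q'.bit = false ∧ q'.colours = q.colours ∧
      q'.fail = (q.fail || decide (Fails q.colours.val (view G st v))) ∧
      ∀ T b, (machine r).Halts q'
        (table G (update G q.colours st v) (fun _ => false) (nextFocus n v)) T b →
        (machine r).Halts q (table G st t v) (T + 1) b := by
  have hB := sweep_back_table G st t v hs hb
  obtain ⟨c, c', e⟩ := sweep_forth_table G st hv
    (q := (machine r).turn { q with seen := view G st v }) rfl rfl
  refine ⟨(machine r).restart { (machine r).turn { q with seen := view G st v } with
    rowCarry := c, colCarry := c' }, rfl, rfl, rfl, rfl, fun T b h => .round ?_ ?_⟩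
  · rw [hB]
    simp only [machine, finished_view, hF, if_false]
  · rw [hB, e]
    exact h

/-- Induction on the potential and, inside it, on the distance of the focus from an enabled vertex
`u`. Idle rounds change no status, so `u` stays enabled until the focus arrives, and each step of
the search takes at most `n + 1` rounds. -/
theorem exists_halts {G : SimpleGraph (Fin n)} (hG : ∀ s p, IsCycleSeq G s p → s < r)
    (q : Ctrl r) (st : Fin n → Status r) (t : ℕ → Bool) {v : ℕ} (hv : v ≤ n) (hs : q.seen = ∅)
    (hb : q.bit = false) (hV : Valid G q.colours st (q.fail = true)) :
    ∃ T ≤ potential st * (n + 1),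
      (machine r).Halts q (table G st t v) T (decide (G.Colorable q.colours)) := by
  obtain ⟨N, hN⟩ : ∃ N, potential st = N := ⟨_, rfl⟩
  induction N using Nat.strong_induction_on generalizing q st t v with
  | _ N ih =>
  by_cases hF : ∀ u, st u ≠ .unvisited ∧ ∀ l S, st u ≠ .active l true S
  · exact ⟨0, Nat.zero_le _, halts_of_finished G st t v hs hb (by omega) hV hF⟩
  obtain ⟨u, hu⟩ : ∃ u, Enabled (Set.range (info G st u)) := by
    have hF' := hF
    push Not at hF'
    obtain ⟨u, hu⟩ := hF'
    refine exists_enabled hV (v := u) ?_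
    by_cases h : st u = .unvisited
    · exact Or.inl h
    · exact Or.inr (hu h)
  rw [← view_eq] at hu
  suffices H : ∀ d q v t, q.seen = ∅ → q.bit = false → Valid G q.colours st (q.fail = true) →
      v ≤ n → distance n v u = d → ∃ T ≤ d + 1 + (N - 1) * (n + 1),
      (machine r).Halts q (table G st t v) T (decide (G.Colorable q.colours)) by
    obtain ⟨T, hT, h⟩ := H _ q v t hs hb hV hv rfl
    refine ⟨T, hT.trans ?_, h⟩
    have hd : distance n v u ≤ n := by
      have := u.2
      unfold distance
      split_ifs <;> omega
    have hN0 : 1 ≤ N := by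
      have hF' := hF
      push Not at hF'
      obtain ⟨w, hw⟩ := hF'
      have h₁ : weight (st w) ≤ N := by
        rw [← hN]
        exact Finset.single_le_sum (f := fun j => weight (st j)) (fun _ _ => Nat.zero_le _)
          (Finset.mem_univ w)
      have h₂ : 1 ≤ weight (st w) := by
        rcases hw' : st w with _ | _ | ⟨l, b, S⟩
        · simp [weight]
        · obtain ⟨l, S, e⟩ := hw (by simp [hw'])
          rw [hw'] at e
          cases e
        · simp [weight]
      omega
    rw [hN]
    obtain ⟨M, rfl⟩ : ∃ M, N = M + 1 := ⟨N - 1, by omega⟩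
    rw [Nat.add_sub_cancel, Nat.add_mul]
    omega
  -- An enabled vertex in focus, be it `u` or one met earlier, lowers the potential.
  have hEn : ∀ q v t, q.seen = ∅ → q.bit = false → Valid G q.colours st (q.fail = true) →
      v ≤ n → Enabled (view G st v) → ∃ T ≤ 1 + (N - 1) * (n + 1),
      (machine r).Halts q (table G st t v) T (decide (G.Colorable q.colours)) := by
    intro q v t hs hb hV hv hE
    have hvn : v < n := by
      refine lt_of_le_of_ne hv fun e => ?_
      rw [e] at hE
      exact not_enabled_view G st hE
    obtain ⟨w, rfl⟩ : ∃ w : Fin n, v = w := ⟨⟨v, hvn⟩, rfl⟩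
    have hstep := update_eq_step G q.colours st w
    rw [view_eq] at hE
    obtain ⟨h₁, h₂, h₃⟩ := valid_step hG hV hE
    rw [← hstep] at h₁ h₂ h₃
    rw [← view_eq] at h₁
    have hpot : potential (update G q.colours st w) < N := by
      rw [← hN]
      exact Finset.sum_lt_sum (fun j _ => h₂ j) ⟨w, Finset.mem_univ w, h₃⟩
    obtain ⟨q', hs', hb', hc', hf', H⟩ := halts_round G st t hv hs hb hF
    rw [← hc'] at hpot h₁ H ⊢
    obtain ⟨T, hT, hH⟩ := ih _ hpot q' (update G q'.colours st w) (fun _ => false)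
      (v := nextFocus n w) (by unfold nextFocus; split_ifs <;> omega) hs' hb'
      (by rw [hf', ← hc']; simpa using h₁) rfl
    refine ⟨T + 1, ?_, H T _ hH⟩
    have : T ≤ (N - 1) * (n + 1) := hT.trans (Nat.mul_le_mul_right _ (by omega))
    omega
  intro d
  induction d with
  | zero =>
    intro q v t hs hb hV hv hd
    have hvu : v = u := by
      have := u.2
      unfold distance at hd
      split_ifs at hd <;> omega
    subst hvu
    simpa [add_comm] using hEn q u t hs hb hV hv hu
  | succ d ihd =>
    intro q v t hs hb hV hv hd
    by_cases hE : Enabled (view G st v)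
    · obtain ⟨T, hT, h⟩ := hEn q v t hs hb hV hv hE
      exact ⟨T, by omega, h⟩
    obtain ⟨q', hs', hb', hc', hf', H⟩ := halts_round G st t hv hs hb hF
    have hup : update G q.colours st v = st := by
      funext j
      exact next_of_not_enabled hE _
    rw [hup] at H
    rw [decide_eq_false (not_fails_of_not_enabled hE), Bool.or_false] at hf'
    obtain ⟨T, hT, hH⟩ := ihd q' (nextFocus n v) (fun _ => false) hs' hb'
      (by rw [hf', hc']; exact hV) (by unfold nextFocus; split_ifs <;> omega) (by
        have := u.2
        unfold distance at hd ⊢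
        unfold nextFocus
        split_ifs at hd ⊢ <;> omega)
    rw [hc'] at hH
    exact ⟨T + 1, by omega, H T _ hH⟩

end Search

/-! ### Reading the input word. -/

section Input

variable {r : ℕ}

/-- Truncation respects sums, so truncated counters suffice to evaluate the binary expansion. -/
theorem cutoff_add (x y : ℕ) :
    cutoff r ((cutoff r x).val + (cutoff r y).val) = cutoff r (x + y) := by
  apply Fin.ext
  simp only [cutoff]
  omega

theorem cutoff_two_mul (x : ℕ) : cutoff r (2 * (cutoff r x).val) = cutoff r (2 * x) := by
  rw [two_mul, cutoff_add, two_mul]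

variable [NeZero r]

theorem read_digit (b : Bool) {q : Ctrl r} (hq : q.started = false) {x y : ℕ}
    (hx : q.colours = cutoff r x) (hy : q.place = cutoff r y) :
    (machine r).read q (some b) =
      ({ q with
        colours := cutoff r (x + if b then y else 0)
        place := cutoff r (2 * y) }, none) := by
  simp only [machine, hq, hx, hy, cutoff_two_mul]
  cases b
  · have := cutoff_add (r := r) x 0
    simp only [cutoff, Nat.min_zero, add_zero] at this
    simp [cutoff]
  · simp [cutoff_add]

/-- The digits come least significant first: `x` is the value read so far and `y` the current place
value. -/
theorem readAll_posNum (p : PosNum) {q : Ctrl r} (hq : q.started = false) {x y : ℕ}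
    (hx : q.colours = cutoff r x) (hy : q.place = cutoff r y) (acc : List (Cell r)) :
    ∃ z, (machine r).readAll q ((Computability.encodePosNum p).map some) acc =
      ({ q with colours := cutoff r (x + y * (p : ℕ)), place := z }, acc) := by
  induction p generalizing q x y with
  | one =>
    refine ⟨cutoff r (2 * y), ?_⟩
    simp only [Computability.encodePosNum, List.map_cons, List.map_nil, readAll,
      read_digit true hq hx hy]
    simp
  | bit0 p ih =>
    obtain ⟨z, hz⟩ := ih (q := ((machine r).read q (some false)).1)
      (by rw [read_digit false hq hx hy]; exact hq) (x := x) (y := 2 * y)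
      (by rw [read_digit false hq hx hy]; rfl) (by rw [read_digit false hq hx hy])
    refine ⟨z, ?_⟩
    simp only [Computability.encodePosNum, List.map_cons, readAll]
    rw [read_digit false hq hx hy] at hz ⊢
    refine hz.trans ?_
    simp only [PosNum.cast_bit0]
    congr 3
    ring
  | bit1 p ih =>
    obtain ⟨z, hz⟩ := ih (q := ((machine r).read q (some true)).1)
      (by rw [read_digit true hq hx hy]; exact hq) (x := x + y) (y := 2 * y)
      (by rw [read_digit true hq hx hy]; rfl) (by rw [read_digit true hq hx hy])
    refine ⟨z, ?_⟩
    simp only [Computability.encodePosNum, List.map_cons, readAll]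
    rw [read_digit true hq hx hy] at hz ⊢
    refine hz.trans ?_
    simp only [PosNum.cast_bit1]
    congr 3
    ring

theorem readAll_nat (k : ℕ) :
    ∃ z, (machine r).readAll (machine r).init ((Computability.encodeNat k).map some) [] =
      ({ (machine r).init with colours := cutoff r k, place := z }, []) := by
  have hk : ((k : Num) : ℕ) = k := Num.to_of_nat k
  unfold Computability.encodeNat
  generalize (k : Num) = m at hk
  subst hk
  cases m with
  | zero => exact ⟨cutoff r 1, rfl⟩
  | pos p =>
    obtain ⟨z, hz⟩ := readAll_posNum p (q := (machine r).init) rfl (x := 0) (y := 1) rfl rfl []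
    refine ⟨z, hz.trans ?_⟩
    simp

theorem readAll_entries (a : ℕ → Bool) (i len : ℕ) {q : Ctrl r} (hs : q.started = true)
    (hq : q.colCarry = (i == 0)) (acc : List (Cell r)) :
    (machine r).readAll q ((List.range' i len).map fun j => some (a j)) acc =
      ({ q with colCarry := (i + len == 0) }, (entries a 0 i len).reverse ++ acc) := by
  induction len generalizing i q acc with
  | zero =>
    rw [add_zero, ← hq]
    rfl
  | succ len ih =>
    have hr : (machine r).read q (some (a i)) =
        ({ q with colCarry := false }, some (.entry (a i) (i == 0))) := by
      simp [machine, hs, hq]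
    rw [List.range'_succ, List.map_cons, readAll, hr]
    refine (ih (i + 1) (q := { q with colCarry := false }) hs (by simp) _).trans ?_
    rw [entries_succ]
    simp [show i + 1 + len = i + (len + 1) by omega]

theorem readAll_rows {n : ℕ} (a : ℕ → ℕ → Bool) (i len : ℕ) {q : Ctrl r}
    (hq : q.rowCarry = (i == 0)) (acc : List (Cell r)) :
    ∃ b b' b'', (machine r).readAll q ((List.range' i len).flatMap fun i =>
        none :: (List.range' 0 n).map fun j => some (a i j)) acc =
      ({ q with started := b, rowCarry := b', colCarry := b'' },
        (rows n a (fun _ => .unvisited) (fun _ => false) 0 i len).reverse ++ acc) := by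
  induction len generalizing i q acc with
  | zero => exact ⟨_, _, _, rfl⟩
  | succ len ih =>
    have hr : (machine r).read q none =
        ({ q with started := true, rowCarry := (i + 1 == 0), colCarry := (0 == 0) },
          some (.header .unvisited (i == 0) false)) := by
      simp [machine, hq]
    rw [List.range'_succ, List.flatMap_cons, List.cons_append, readAll, hr, readAll_append,
      readAll_entries (a i) 0 n rfl rfl]
    obtain ⟨b, b', b'', e⟩ := ih (i + 1)
      (q := { q with started := true, rowCarry := (i + 1 == 0), colCarry := (0 + n == 0) }) rfl
      ((entries (a i) 0 0 n).reverse ++ .header .unvisited (i == 0) false :: acc)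
    refine ⟨b, b', b'', e.trans ?_⟩
    rw [rows_succ]
    simp

theorem encode_eq (I : ColouringInstance) :
    I.encode = (Computability.encodeNat I.k).map some ++
      (List.range' 0 I.n).flatMap fun i =>
        none :: (List.range' 0 I.n).map fun j => some (matrix I.graph i j) := by
  rw [ColouringInstance.encode, ← List.range_eq_range', ← List.map_coe_finRange_eq_range,
    List.flatMap_map]
  congr 1
  refine List.flatMap_congr fun i _ => ?_
  rw [List.map_map]
  congr 1
  refine List.map_congr_left fun j _ => ?_
  simp [matrix]

theorem le_length_encode (I : ColouringInstance) : I.n ≤ I.encode.length := by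
  rw [encode_eq, List.length_append, List.length_flatMap]
  simp only [List.length_cons, List.length_map, List.length_range', List.map_const',
    List.sum_replicate, smul_eq_mul]
  nlinarith [Nat.zero_le I.n, Nat.zero_le ((Computability.encodeNat I.k).map some).length]

theorem readAll_encode (I : ColouringInstance) :
    ∃ q : Ctrl r, q.colours = cutoff r I.k ∧ q.seen = ∅ ∧ q.bit = false ∧ q.fail = false ∧
      (machine r).readAll (machine r).init I.encode [] =
        (q, table I.graph (fun _ => .unvisited) (fun _ => false) 0) := by
  obtain ⟨z, hz⟩ := readAll_nat (r := r) I.k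
  obtain ⟨b, b', b'', e⟩ := readAll_rows (n := I.n) (matrix I.graph) 0 I.n
    (q := { (machine r).init with colours := cutoff r I.k, place := z }) rfl []
  refine ⟨{ (machine r).init with
    colours := cutoff r I.k, place := z, started := b, rowCarry := b', colCarry := b'' },
    rfl, rfl, rfl, rfl, ?_⟩
  rw [encode_eq, readAll_append, hz]
  refine e.trans (Prod.ext rfl ?_)
  rw [List.append_nil, table]
  simp only
  congr 1
  refine rows_congr fun j hj => ?_
  rw [zero_add] at hj
  simp [extend, hj]

end Input

/-! ### Conclusion. -/

theorem isCycleSeq_lt {V : Type} [Finite V] {G : SimpleGraph V} {r : ℕ} (hr : 3 ≤ r)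
    (hG : ¬ HasTopologicalMinor (SimpleGraph.cycleGraph r) G) (s : ℕ) (p : ℕ → V)
    (h : IsCycleSeq G s p) : s < r := by
  by_contra hs
  exact hG (h.hasTopologicalMinor hr (not_lt.1 hs))

theorem potential_unvisited (r n : ℕ) :
    potential (fun _ : Fin n => (.unvisited : Status r)) = 2 * n := by
  simp [potential, weight, mul_comm]

theorem exists_halts_encode {r : ℕ} [NeZero r] (I : ColouringInstance)
    (hG : ∀ s p, IsCycleSeq I.graph s p → s < r) :
    ∃ T ≤ 2 * I.n * (I.n + 1),
      (machine r).Halts ((machine r).readAll (machine r).init I.encode []).1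
        ((machine r).readAll (machine r).init I.encode []).2 T I.answer := by
  obtain ⟨q, hc, hs, hb, hf, e⟩ := readAll_encode (r := r) I
  obtain ⟨T, hT, h⟩ := exists_halts hG q (fun _ => .unvisited) (fun _ => false) (Nat.zero_le _)
    hs hb (by simpa [hf] using valid_init I.graph _)
  rw [potential_unvisited] at hT
  refine ⟨T, hT, ?_⟩
  rw [e]
  convert h using 1
  rw [ColouringInstance.answer, decide_eq_decide, hc]
  have hr := colorable_of_no_long_cycle hG
  -- The machine decides `min r k`-colourability; for `k ≥ r` both answers are yes, as the graph is
  -- `r`-colourable.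
  rcases le_total I.k r with hk | hk
  · simp [cutoff, hk]
  · simp only [cutoff, min_eq_left hk]
    exact iff_of_true (hr.mono hk) hr

end ColouringMachine

theorem theorem4p9 (r : ℕ) (hr : 3 ≤ r) :
    ColouringPolyTimeSolvableOn fun _ G => ¬ HasTopologicalMinor (SimpleGraph.cycleGraph r) G := by
  have : NeZero r := ⟨by omega⟩
  have := Fintype.ofFinite (ColouringMachine.Ctrl r)
  have := Fintype.ofFinite (ColouringMachine.Cell r)
  refine Sweeper.nonempty_polyTime (ColouringMachine.machine r) _ _
    (2 * Polynomial.X * (Polynomial.X + 1)) fun I => ?_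
  obtain ⟨T, hT, h⟩ := ColouringMachine.exists_halts_encode I.1
    (ColouringMachine.isCycleSeq_lt hr I.2)
  refine ⟨T, hT.trans ?_, h⟩
  have := ColouringMachine.le_length_encode I.1
  simp only [Polynomial.eval_mul, Polynomial.eval_add, Polynomial.eval_X, Polynomial.eval_one,
    Polynomial.eval_ofNat]
  gcongr
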